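/- All graphs are finite and simple. For a graph $G$, let $\lambda(G)$ denote its spectral radius, i.e. the maximum of the absolute values of the eigenvalues of its adjacency matrix. A graph is 2-connected if it has at least three vertices, is connected, and remains connected after the deletion of any one vertex. For integers with $2s\le k$ and $k-s\le n$, let $W_{n,k,s}=K_s\vee\big((n-k+s)K_1\cup K_{k-2s}\big)$, that is, the $n$-vertex graph whose vertex set is partitioned into $X,Y,Z$ with $|X|=s$, $|Y|=k-2s$, $|Z|=n-k+s$, and whose edges are all pairs between $X$ and $Z$ and all pairs inside $X\cup Y$. Let $P_k$ be the path with $k$ vertices, $\mathcal C_{\ge k}$ the family of all cycles of length at least $k$, and $M_{m}$ the matching consisting of $m$ independent edges. Let $spex_{c}(n,\mathcal H)$ (respectively $spex_{2\text{-}con}(n,\mathcal H)$) denote the maximum of $\lambda(G)$ over all connected (respectively 2-connected) $n$-vertex graphs $G$ containing no member of $\mathcal H$ as a subgraph. **Theorem.** (i) Let $n\ge k\ge 5$ and $t=\lfloor (k-1)/2\rfloor$. If $G$ is a 2-connected $n$-vertex graph with $\lambda(G)>\max_{2\le s\le t}\lambda(W_{n,k,s})$, then $G$ has a cycle of length at least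 $k$. Moreover, $spex_{2\text{-}con}(n,\mathcal C_{\ge k})=\max_{2\le s\le t}\lambda(W_{n,k,s})$. (ii) Let $n\ge k\ge 4$ and $t=\lfloor k/2\rfloor-1$. If $G$ is a connected $n$-vertex graph with $\lambda(G)>\max_{1\le s\le t}\lambda(W_{n,k-1,s})$, then $G$ contains $P_k$ as a subgraph. Moreover, $spex_{c}(n,P_k)=\max_{1\le s\le t}\lambda(W_{n,k-1,s})$. (iii) Let $k\ge 1$ and $n\ge 2k+2$. If $G$ is a connected $n$-vertex graph with $\lambda(G)>\max_{1\le s\le k}\lambda(W_{n,2k+1,s})$, then $G$ contains $M_{k+1}$ as a subgraph. Moreover, $spex_{c}(n,M_{k+1})=\max_{1\le s\le k}\lambda(W_{n,2k+1,s})$. -/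

import Mathlib

/-- The (real) adjacency matrix of a simple graph is Hermitian. -/
theorem isHermitian_adjMatrix_real {V : Type*} (G : SimpleGraph V)
    [DecidableRel G.Adj] : (G.adjMatrix ℝ).IsHermitian := by
  rw [Matrix.IsHermitian, Matrix.conjTranspose_eq_transpose_of_trivial]
  exact G.isSymm_adjMatrix

open Classical in
/-- The spectral radius `λ(G) = max |λᵢ|` of a finite simple graph, where `λ₁, …, λₙ` are
the eigenvalues of its adjacency matrix. -/
noncomputable def graphSpectralRadius {V : Type*} [Fintype V] (G : SimpleGraph V) : ℝ :=
  ⨆ i : V, |(isHermitian_adjMatrix_real G).eigenvalues i|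

/-- The graph `W_{n,k,s} = K_s ∨ ((n - k + s) K₁ ∪ K_{k - 2s})` (for `2s ≤ k` and `k - s ≤ n`) on
the vertex set `{0, …, n - 1}`: with `X = {0, …, s - 1}`, `Y = {s, …, k - s - 1}` and
`Z = {k - s, …, n - 1}`, its edges are all pairs between `X` and `Z` and all pairs in `X ∪ Y`. -/
def graphW (n k s : ℕ) : SimpleGraph (Fin n) where
  Adj u v := u ≠ v ∧
    ((u : ℕ) < s ∨ (v : ℕ) < s ∨ ((u : ℕ) < k - s ∧ (v : ℕ) < k - s))
  symm := ⟨fun _ _ h => ⟨h.1.symm, by tauto⟩⟩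
  loopless := ⟨fun _ h => h.1 rfl⟩

/-- A finite graph is 2-connected if it has at least three vertices, is connected, and stays
connected after the deletion of any one vertex. -/
def IsTwoConnected {V : Type*} [Fintype V] (G : SimpleGraph V) : Prop :=
  3 ≤ Fintype.card V ∧ G.Connected ∧ ∀ v : V, (G.induce ({v}ᶜ : Set V)).Connected

/-- `G` has a cycle of length at least `k`, i.e. contains a member of `𝒞_{≥ k}`. -/
def HasCycleAtLeast {V : Type*} (G : SimpleGraph V) (k : ℕ) : Prop :=
  ∃ (v : V) (p : G.Walk v v), p.IsCycle ∧ k ≤ p.length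

/-- `G` has a path of order `k` (a path with exactly `k` vertices), i.e. contains `P_k`. -/
def HasPathOfOrder {V : Type*} (G : SimpleGraph V) (k : ℕ) : Prop :=
  ∃ (u v : V) (p : G.Walk u v), p.IsPath ∧ p.support.length = k

/-- `G` contains a matching of exactly `m` independent edges, i.e. contains `M_m`. -/
def HasMatchingOfSize {V : Type*} (G : SimpleGraph V) (m : ℕ) : Prop :=
  ∃ M : G.Subgraph, M.IsMatching ∧ M.edgeSet.Finite ∧ M.edgeSet.ncard = m

/-- `r` is the maximum spectral radius `spex_{2-con}(n, 𝒞_{≥ k})` of a 2-connected graph on `n`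
vertices without a cycle of length at least `k`. -/
def IsSpexTwoConnectedCycles (n k : ℕ) (r : ℝ) : Prop :=
  IsGreatest {x : ℝ | ∃ G : SimpleGraph (Fin n),
    IsTwoConnected G ∧ ¬ HasCycleAtLeast G k ∧ graphSpectralRadius G = x} r

/-- `r` is the maximum spectral radius `spex_c(n, P_k)` of a connected graph on `n` vertices
without a path of order `k`. -/
def IsSpexConnectedPath (n k : ℕ) (r : ℝ) : Prop :=
  IsGreatest {x : ℝ | ∃ G : SimpleGraph (Fin n),
    G.Connected ∧ ¬ HasPathOfOrder G k ∧ graphSpectralRadius G = x} r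

/-- `r` is the maximum spectral radius `spex_c(n, M_m)` of a connected graph on `n` vertices
without a matching of `m` edges. -/
def IsSpexConnectedMatching (n m : ℕ) (r : ℝ) : Prop :=
  IsGreatest {x : ℝ | ∃ G : SimpleGraph (Fin n),
    G.Connected ∧ ¬ HasMatchingOfSize G m ∧ graphSpectralRadius G = x} r

/-- The maximum `max_{a ≤ s ≤ b} λ(W_{n,k,s})` over the nonempty range `a ≤ s ≤ b`. -/
noncomputable def maxRadiusW (n k a b : ℕ) (hab : a ≤ b) : ℝ :=
  (Finset.Icc a b).sup' (Finset.nonempty_Icc.mpr hab) fun s => graphSpectralRadius (graphW n k s)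

/-! The extremal problems are reduced to a degeneracy condition, `IsDegenerateAbove (k - s) s`:
every set of more than k - s vertices contains a vertex with at most s neighbours in the set.

Structure. By Kopylov's argument, a 2-connected graph without cycles of length at least k satisfies
this condition for some 2 ≤ s ≤ (k-1)/2 (`exists_isDegenerateAbove`). The engine is a Pósa-type
lemma (`PathOn.hasCycleAtLeast_of_degree`): without cut vertices, a path with nonadjacent ends x, y
forces a cycle of length at least the minimum of its order and d(x) + d(y), degrees being counted on
the path. In an edge-maximal graph nonadjacent vertices are joined by paths of order at least k, so
the lemma makes sets of large minimum degree completely adjacent to one another.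

Spectrum. Order the vertices by decreasing entries of a nonnegative vector attaining the spectral
radius. Peeling off vertices of small degree bounds the adjacent ordered pairs in any product of two
prefixes, and `graphW n k s` meets all these bounds at once (`IsDegenerateAbove.prefix_le`).
Summation by parts in both variables turns domination of prefix counts into domination of quadratic
forms at decreasing nonnegative vectors, hence of spectral radii.

Paths and matchings. Adding a dominating vertex turns a connected graph into one without cut
vertices, and a cycle of length at least k + 1 there yields a path on k vertices below. A path on 2k
+ 2 vertices contains k + 1 independent edges. Counting in `graphW` shows that the bounds are
attained. -/

namespace SimpleGraph

/-! ### Paths recorded by their ends and vertex set. -/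

variable {V : Type*} {G : SimpleGraph V}

/-- There is a path from `a` to `b` whose vertex set is `S`. -/
def PathOn (G : SimpleGraph V) (a b : V) (S : Finset V) : Prop :=
  ∃ p : G.Walk a b, p.IsPath ∧ ∀ x, x ∈ p.support ↔ x ∈ S

namespace PathOn

variable {a b c d : V} {S T : Finset V}

theorem start_mem (h : G.PathOn a b S) : a ∈ S := by
  obtain ⟨p, -, hS⟩ := h
  exact (hS a).1 p.start_mem_support

theorem end_mem (h : G.PathOn a b S) : b ∈ S := by
  obtain ⟨p, -, hS⟩ := h
  exact (hS b).1 p.end_mem_support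

theorem symm (h : G.PathOn a b S) : G.PathOn b a S := by
  obtain ⟨p, hp, hS⟩ := h
  exact ⟨p.reverse, hp.reverse, by simpa using hS⟩

theorem refl (a : V) : G.PathOn a a {a} := ⟨Walk.nil, by simp, by simp⟩

theorem of_isPath [DecidableEq V] {p : G.Walk a b} (hp : p.IsPath) :
    G.PathOn a b p.support.toFinset := ⟨p, hp, by simp⟩

theorem support_length (p : G.Walk a b) (hp : p.IsPath) (hS : ∀ x, x ∈ p.support ↔ x ∈ S) :
    p.support.length = S.card := by
  classical
  rw [← List.toFinset_card_of_nodup hp.support_nodup]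
  congr 1
  ext x
  simp [hS]

/-- Close a path to a cycle. -/
theorem hasCycleAtLeast {k : ℕ} (h : G.PathOn a b S) (hab : G.Adj a b) (h3 : 3 ≤ S.card)
    (hk : k ≤ S.card) : HasCycleAtLeast G k := by
  obtain ⟨p, hp, hS⟩ := h
  have hl := support_length p hp hS
  rw [Walk.length_support] at hl
  refine ⟨b, Walk.cons hab.symm p, ?_, ?_⟩
  · rw [Walk.cons_isCycle_iff]
    refine ⟨hp, fun he => ?_⟩
    -- A path that uses the edge between its own ends is that single edge, which has too few
    -- vertices for `h3`.
    have : p.length = 1 := by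
      cases p with
      | nil => simp at he
      | @cons u v w huv q =>
        rw [Walk.cons_isPath_iff] at hp
        rw [Walk.edges_cons, List.mem_cons] at he
        rcases he with he | he
        · have : v = b := by
            rw [Sym2.eq_swap, Sym2.congr_right] at he
            exact he.symm
          subst this
          have := Walk.length_eq_zero_iff.2 (Walk.isPath_iff_nil.1 hp.1)
          simp [this]
        · exact absurd (Walk.snd_mem_support_of_mem_edges q he) hp.2
    omega
  · rw [Walk.length_cons]
    omega

variable [DecidableEq V]

/-- Prepend an edge. -/
theorem cons (h : G.PathOn b c S) (hab : G.Adj a b) (ha : a ∉ S) :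
    G.PathOn a c (insert a S) := by
  obtain ⟨p, hp, hS⟩ := h
  refine ⟨Walk.cons hab p, ?_, ?_⟩
  · rw [Walk.cons_isPath_iff]
    exact ⟨hp, fun h => ha ((hS a).1 h)⟩
  · intro x
    simp [hS]

/-- Concatenate two vertex-disjoint paths along an edge. -/
theorem join (h₁ : G.PathOn a b S) (h₂ : G.PathOn c d T) (hbc : G.Adj b c)
    (hd : Disjoint S T) : G.PathOn a d (S ∪ T) := by
  obtain ⟨p, hp, hS⟩ := h₁
  induction p generalizing S with
  | @nil u =>
    have : S = {u} := by
      ext x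
      rw [← hS x]
      simp
    subst this
    rw [Finset.singleton_union]
    exact h₂.cons hbc (Finset.disjoint_singleton_left.1 hd)
  | @cons u v w huv p ih =>
    rw [Walk.cons_isPath_iff] at hp
    have hu : u ∈ S := (hS u).1 (by simp)
    have hS' : ∀ x, x ∈ p.support ↔ x ∈ S.erase u := by
      intro x
      rw [Finset.mem_erase, ← hS x]
      simp only [Walk.support_cons, List.mem_cons]
      constructor
      · intro h
        exact ⟨fun hx => hp.2 (hx ▸ h), Or.inr h⟩
      · rintro ⟨h1, h2 | h2⟩
        · exact absurd h2 h1
        · exact h2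
    have := ih hbc (hd.mono_left (Finset.erase_subset _ _)) hp.1 hS'
    have h := this.cons huv (by
      simp only [Finset.mem_union, Finset.mem_erase, ne_eq, not_true_eq_false, false_and, false_or]
      exact Finset.disjoint_left.1 hd hu)
    rwa [← Finset.insert_union, Finset.insert_erase hu] at h

/-- Concatenate two paths that share exactly the common end. -/
theorem append (h₁ : G.PathOn a b S) (h₂ : G.PathOn b d T)
    (hd : ∀ x ∈ S, x ∈ T → x = b) : G.PathOn a d (S ∪ T) := by
  obtain ⟨p, hp, hT⟩ := h₂
  cases p with
  | nil =>
    have : T = {b} := by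
      ext x
      rw [← hT x]
      simp
    subst this
    rwa [Finset.union_singleton, Finset.insert_eq_of_mem h₁.end_mem]
  | @cons u v w huv p =>
    rw [Walk.cons_isPath_iff] at hp
    have hb : b ∈ T := (hT b).1 (by simp)
    have h2 : G.PathOn v d (T.erase b) := by
      refine ⟨p, hp.1, fun x => ?_⟩
      rw [Finset.mem_erase, ← hT x]
      simp only [Walk.support_cons, List.mem_cons]
      constructor
      · intro h
        exact ⟨fun hx => hp.2 (hx ▸ h), Or.inr h⟩
      · rintro ⟨h1, h2 | h2⟩
        · exact absurd h2 h1
        · exact h2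
    have := h₁.join h2 huv (by
      rw [Finset.disjoint_left]
      intro x hx hx'
      rw [Finset.mem_erase] at hx'
      exact hx'.1 (hd x hx hx'.2))
    convert this using 1
    ext x
    simp only [Finset.mem_union, Finset.mem_erase]
    by_cases hx : x = b
    · subst hx
      simp [h₁.end_mem]
    · simp [hx]

end PathOn

theorem _root_.HasCycleAtLeast.exists_pathOn [DecidableEq V] {k : ℕ} (h : HasCycleAtLeast G k) :
    ∃ (a b : V) (S : Finset V), G.PathOn a b S ∧ G.Adj a b ∧ 3 ≤ S.card ∧ k ≤ S.card := by
  obtain ⟨v, p, hp, hk⟩ := h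
  have h3 := hp.three_le_length
  cases p with
  | nil => simp at h3
  | @cons u w x huv q =>
    rw [Walk.cons_isCycle_iff] at hp
    have hc : q.support.toFinset.card = q.length + 1 := by
      rw [List.toFinset_card_of_nodup hp.1.support_nodup, Walk.length_support]
    rw [Walk.length_cons] at h3 hk
    exact ⟨w, v, _, PathOn.of_isPath hp.1, huv.symm, by omega, by omega⟩

/-- Any two vertices of a connected set are joined by a path in that set. -/
theorem exists_pathOn_of_preconnected_induce [DecidableEq V] {C : Set V}
    (hC : (G.induce C).Preconnected) {a b : V} (ha : a ∈ C) (hb : b ∈ C) :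
    ∃ S : Finset V, G.PathOn a b S ∧ (S : Set V) ⊆ C := by
  obtain ⟨p, hp⟩ := (hC ⟨a, ha⟩ ⟨b, hb⟩).exists_isPath
  have key : ∀ (c d : C) (q : (G.induce C).Walk c d), q.IsPath →
      ∃ S : Finset V, G.PathOn c d S ∧ ∀ x, x ∈ S → ∃ y ∈ q.support, (y : V) = x := by
    intro c d q
    induction q with
    | @nil u => exact fun _ => ⟨{(u : V)}, PathOn.refl _, by simp⟩
    | @cons u v w huv q ih =>
      intro hq
      rw [Walk.cons_isPath_iff] at hq
      obtain ⟨S, hS, hS'⟩ := ih hq.1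
      refine ⟨insert (u : V) S, hS.cons huv fun hu => ?_, fun x hx => ?_⟩
      · obtain ⟨y, hy, hyu⟩ := hS' _ hu
        exact hq.2 (Subtype.ext hyu ▸ hy)
      · rcases Finset.mem_insert.1 hx with rfl | hx
        · exact ⟨u, by simp, rfl⟩
        · obtain ⟨y, hy, rfl⟩ := hS' _ hx
          exact ⟨y, by simp [hy], rfl⟩
  obtain ⟨S, hS, hS'⟩ := key _ _ p hp
  refine ⟨S, hS, fun x hx => ?_⟩
  obtain ⟨y, -, rfl⟩ := hS' x hx
  exact y.2

/-- Segments of a sequence of distinct, consecutively adjacent vertices are paths. -/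
theorem pathOn_image_Icc [DecidableEq V] {v : ℕ → V} {m : ℕ} (hinj : Set.InjOn v (Set.Iio m))
    (hadj : ∀ i, i + 1 < m → G.Adj (v i) (v (i + 1))) {i j : ℕ} (hij : i ≤ j) (hj : j < m) :
    G.PathOn (v i) (v j) ((Finset.Icc i j).image v) := by
  induction j, hij using Nat.le_induction with
  | base => simpa using PathOn.refl (G := G) (v i)
  | succ j hij ih =>
    have h := (ih (by omega)).join (PathOn.refl (v (j + 1))) (hadj j hj) (by
      rw [Finset.disjoint_singleton_right, Finset.mem_image]
      rintro ⟨l, hl, he⟩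
      rw [Finset.mem_Icc] at hl
      have := hinj (Set.mem_Iio.2 (by omega)) (Set.mem_Iio.2 hj) he
      omega)
    convert h using 1
    ext x
    simp only [Finset.mem_image, Finset.mem_Icc, Finset.mem_union, Finset.mem_singleton]
    constructor
    · rintro ⟨l, hl, rfl⟩
      rcases Nat.lt_or_ge j l with h | h
      · right
        congr 1
        omega
      · exact Or.inl ⟨l, by omega, rfl⟩
    · rintro (⟨l, hl, rfl⟩ | rfl)
      · exact ⟨l, by omega, rfl⟩
      · exact ⟨j + 1, by omega, rfl⟩

/-- Enumeration of the vertices of a path. -/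
theorem PathOn.exists_enum [DecidableEq V] {a b : V} {S : Finset V} (h : G.PathOn a b S) :
    ∃ v : ℕ → V, Set.InjOn v (Set.Iio S.card) ∧
      (∀ i, i + 1 < S.card → G.Adj (v i) (v (i + 1))) ∧ v 0 = a ∧ v (S.card - 1) = b ∧
      (Finset.range S.card).image v = S := by
  obtain ⟨p, hp, hS⟩ := h
  have hl := support_length p hp hS
  rw [Walk.length_support] at hl
  have hinj : Set.InjOn p.getVert (Set.Iio S.card) := by
    intro i hi j hj hij
    rw [Set.mem_Iio] at hi hj
    exact hp.getVert_injOn (by simp; omega) (by simp; omega) hij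
  refine ⟨p.getVert, hinj, ?_, by simp, ?_, ?_⟩
  · intro i hi
    exact p.adj_getVert_succ (by omega)
  · rw [← hl, Nat.add_sub_cancel, Walk.getVert_length]
  · ext x
    rw [← hS x, Walk.mem_support_iff_exists_getVert, Finset.mem_image]
    constructor
    · rintro ⟨i, hi, rfl⟩
      rw [Finset.mem_range] at hi
      exact ⟨i, rfl, by omega⟩
    · rintro ⟨i, rfl, hi⟩
      exact ⟨i, Finset.mem_range.2 (by omega), rfl⟩

end SimpleGraph

/-! ### Two disjoint links between the initial and final segments of a path. -/

namespace SimpleGraph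

variable {V : Type*} {G : SimpleGraph V}

/-- In a connected graph `G - c`, two disjoint sets `Q` and `T` are linked by a connected set that
meets `Q` in one vertex, avoids `T`, and is adjacent to `T`. -/
theorem exists_connector {c : V} (hc : (G.induce ({c}ᶜ : Set V)).Preconnected) {Q T : Set V}
    (hQT : Disjoint Q T) {a b : V} (ha : a ∈ Q) (hac : a ≠ c) (hb : b ∈ T) (hbc : b ≠ c) :
    ∃ (R : Set V) (w z t : V), (G.induce R).Preconnected ∧ w ∈ R ∧ w ∈ Q ∧ (∀ x ∈ R, x ∈ Q → x = w) ∧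
      (∀ x ∈ R, x ∉ T) ∧ c ∉ R ∧ z ∈ R ∧ t ∈ T ∧ G.Adj z t := by
  obtain ⟨p⟩ := hc ⟨a, hac⟩ ⟨b, hbc⟩
  -- `R` is grown backwards along the walk, restarted whenever the next vertex lies in `T` and
  -- frozen once it meets `Q`. The alternative `w = u` records that it is still growing.
  have key : ∀ (u v : ({c}ᶜ : Set V)) (_ : (G.induce ({c}ᶜ : Set V)).Walk u v), (u : V) ∉ T →
      (v : V) ∈ T → ∃ (R : Set V) (w z t : V), (G.induce R).Preconnected ∧ w ∈ R ∧
        (w ∈ Q ∨ w = u) ∧ (∀ x ∈ R, x ∈ Q → x = w) ∧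
        (∀ x ∈ R, x ∉ T) ∧ c ∉ R ∧ z ∈ R ∧ t ∈ T ∧ G.Adj z t := by
    intro u v q
    induction q with
    | nil => exact fun h h' => absurd h' h
    | @cons u u' v huu' q ih =>
      intro hu hv
      have huc : (u : V) ≠ c := u.2
      by_cases hu' : (u' : V) ∈ T
      · refine ⟨{(u : V)}, u, u, u', ?_, rfl, Or.inr rfl, fun x hx _ => hx, ?_, ?_, rfl, hu', huu'⟩
        · exact Preconnected.of_subsingleton
        · rintro x rfl
          exact hu
        · exact fun h => huc h.symm
      · obtain ⟨R, w, z, t, hR, hw, hwu, hRQ, hRT, hcR, hz, ht, hzt⟩ := ih hu' hv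
        by_cases hwQ : w ∈ Q
        · exact ⟨R, w, z, t, hR, hw, Or.inl hwQ, hRQ, hRT, hcR, hz, ht, hzt⟩
        · have hwu' : w = u' := hwu.resolve_left hwQ
          subst hwu'
          refine ⟨{(u : V)} ∪ R, u, z, t, ?_, Or.inl rfl, Or.inr rfl, ?_, ?_, ?_, Or.inr hz, ht, hzt⟩
          · exact (connected_induce_union Preconnected.of_subsingleton hR (Set.mem_singleton _) hw huu').preconnected
          · rintro x (hx | hx) hxQ
            · exact hx
            · exact absurd (hRQ x hx hxQ ▸ hxQ) hwQ
          · rintro x (rfl | hx)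
            · exact hu
            · exact hRT x hx
          · rintro (h | h)
            · exact huc h.symm
            · exact hcR h
  obtain ⟨R, w, z, t, hR, hw, hwu, h⟩ := key _ _ p (Set.disjoint_left.1 hQT ha) hb
  exact ⟨R, w, z, t, hR, hw, hwu.elim id fun h => h ▸ ha, h⟩

/-- Two disjoint connected sets that link the initial segment `v 0, …, v p` of a path to its final
segment `v q, …, v (m - 1)`, with ends `v p` and `v q` and two further vertices. -/
def Linkage (G : SimpleGraph V) (v : ℕ → V) (m p q : ℕ) : Prop :=
  ∃ (i j : ℕ) (a₁ a₂ : V) (C₁ C₂ : Set V), i < p ∧ q < j ∧ j < m ∧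
    ((a₁ = v p ∧ a₂ = v i) ∨ (a₁ = v i ∧ a₂ = v p)) ∧
    (G.induce C₁).Preconnected ∧ (G.induce C₂).Preconnected ∧ Disjoint C₁ C₂ ∧
    a₁ ∈ C₁ ∧ a₂ ∈ C₂ ∧ v q ∈ C₁ ∧ (∃ z ∈ C₂, G.Adj z (v j)) ∧
    (∀ l ≤ p, v l ∈ C₁ → v l = a₁) ∧ (∀ l ≤ p, v l ∈ C₂ → v l = a₂) ∧
    (∀ l, q < l → l < m → v l ∉ C₁) ∧ (∀ l, q ≤ l → l < m → v l ∉ C₂)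

variable {v : ℕ → V} {m p q : ℕ}

theorem Linkage.base (hinj : Set.InjOn v (Set.Iio m)) (h2 : ∀ c, (G.induce ({c}ᶜ : Set V)).Preconnected)
    (hp : 0 < p) (hpm : p + 1 < m) : Linkage G v m p p := by
  have hne : ∀ i j, i < m → j < m → i ≠ j → v i ≠ v j := fun i j hi hj hij h => hij (hinj hi hj h)
  obtain ⟨R, w, z, t, hR, hw, ⟨i, hi, rfl⟩, hRQ, hRT, hcR, hz, ⟨j, hj, rfl⟩, hzt⟩ :=
    exists_connector (h2 (v p)) (Q := {x | ∃ i < p, v i = x}) (T := {x | ∃ j, (p < j ∧ j < m) ∧ v j = x})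
      (by
        rw [Set.disjoint_left]
        rintro _ ⟨i, hi, rfl⟩ ⟨j, hj, h⟩
        exact hne j i hj.2 (by omega) (by omega) h)
      (a := v 0) (b := v (p + 1)) ⟨0, hp, rfl⟩ (hne _ _ (by omega) (by omega) (by omega))
      ⟨p + 1, ⟨by omega, hpm⟩, rfl⟩ (hne _ _ (by omega) (by omega) (by omega))
  refine ⟨i, j, v p, v i, {v p}, R, hi, hj.1, hj.2, Or.inl ⟨rfl, rfl⟩,
    Preconnected.of_subsingleton, hR, ?_, rfl, hw, rfl, ⟨z, hz, hzt⟩, fun l _ h => h, ?_, ?_, ?_⟩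
  · rwa [Set.disjoint_singleton_left]
  · intro l hl h
    rcases hl.lt_or_eq with hl | rfl
    · exact hRQ _ h ⟨l, hl, rfl⟩
    · exact absurd h hcR
  · intro l hl hlm h
    exact hne l p hlm (by omega) (by omega) h
  · intro l hl hlm h
    rcases hl.lt_or_eq with hl | rfl
    · exact hRT _ h ⟨l, ⟨hl, hlm⟩, rfl⟩
    · exact hcR h

/-- The move common to all cases of `Linkage.succ`: one set absorbs `v (q + 1)` while the other
keeps an exit beyond it. The sets are named `C`, `D` because they may exchange roles. -/
theorem Linkage.of_adj (hinj : Set.InjOn v (Set.Iio m)) (hpq : p ≤ q) {i j : ℕ} {a b z₁ z₂ : V}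
    {C D : Set V} (hi : i < p) (hj : q + 1 < j) (hjm : j < m)
    (hab : (a = v p ∧ b = v i) ∨ (a = v i ∧ b = v p))
    (hC : (G.induce C).Preconnected) (hD : (G.induce D).Preconnected) (hCD : Disjoint C D)
    (ha : a ∈ C) (hb : b ∈ D) (hz₁ : z₁ ∈ C) (hz₁q : G.Adj z₁ (v (q + 1))) (hz₂ : z₂ ∈ D)
    (hz₂j : G.Adj z₂ (v j)) (hCp : ∀ l ≤ p, v l ∈ C → v l = a) (hDp : ∀ l ≤ p, v l ∈ D → v l = b)
    (hCq : ∀ l, q < l → l < m → v l ∉ C) (hDq : ∀ l, q < l → l < m → v l ∉ D) :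
    Linkage G v m p (q + 1) := by
  have hne : ∀ i j, i < m → j < m → i ≠ j → v i ≠ v j := fun i j hi hj hij h => hij (hinj hi hj h)
  refine ⟨i, j, a, b, C ∪ {v (q + 1)}, D, hi, hj, hjm, hab,
    (connected_induce_union hC Preconnected.of_subsingleton hz₁ (Set.mem_singleton _) hz₁q).preconnected, hD, ?_,
    Or.inl ha, hb, Or.inr rfl, ⟨z₂, hz₂, hz₂j⟩, ?_, hDp, ?_, fun l hl => hDq l (by omega)⟩
  · rw [Set.disjoint_union_left, Set.disjoint_singleton_left]
    exact ⟨hCD, hDq _ (by omega) (by omega)⟩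
  · rintro l hl (h | h)
    · exact hCp l hl h
    · exact absurd h (hne _ _ (by omega) (by omega) (by omega))
  · rintro l hl hlm (h | h)
    · exact hCq l (by omega) hlm h
    · exact hne _ _ hlm (by omega) (by omega) h

/-- If the exit of `C₂` lies beyond `q + 1`, the path edge extends `C₁`. Otherwise `C₂` exits
exactly at `v (q + 1)`, and since that vertex is not a cut vertex, some connector `R` bypasses it.
If `R` starts in `C₁`, then `C₂` takes `v (q + 1)`; if it starts in `C₂`, then `C₁` does. If it
starts at a fresh vertex of the initial segment, `R` replaces whichever set does not contain `v p`.
-/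
theorem Linkage.succ (hinj : Set.InjOn v (Set.Iio m))
    (hadj : ∀ i, i + 1 < m → G.Adj (v i) (v (i + 1)))
    (h2 : ∀ c, (G.induce ({c}ᶜ : Set V)).Preconnected) (hpq : p ≤ q) (hqm : q + 2 < m)
    (h : Linkage G v m p q) : Linkage G v m p (q + 1) := by
  have hne : ∀ i j, i < m → j < m → i ≠ j → v i ≠ v j := fun i j hi hj hij h => hij (hinj hi hj h)
  obtain ⟨i, j, a₁, a₂, C₁, C₂, hi, hj, hjm, ha, hC₁, hC₂, hd, ha₁, ha₂, hq, ⟨z, hz, hzj⟩, hp₁, hp₂,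
    hq₁, hq₂⟩ := h
  have hq₂' : ∀ l, q < l → l < m → v l ∉ C₂ := fun l hl => hq₂ l hl.le
  have ha' : (a₂ = v p ∧ a₁ = v i) ∨ (a₂ = v i ∧ a₁ = v p) := by tauto
  rcases Nat.lt_or_ge (q + 1) j with hj' | hj'
  · exact Linkage.of_adj hinj hpq hi hj' hjm ha hC₁ hC₂ hd ha₁ ha₂ hq (hadj q (by omega)) hz hzj hp₁
      hp₂ hq₁ hq₂'
  obtain rfl : j = q + 1 := by omega
  have hvp : v p ∈ C₁ ∨ v p ∈ C₂ := by
    rcases ha with ⟨rfl, -⟩ | ⟨-, rfl⟩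
    · exact Or.inl ha₁
    · exact Or.inr ha₂
  obtain ⟨R, w, y, t, hR, hw, hwQ, hRQ, hRT, hcR, hy, ⟨j, hj, rfl⟩, hyt⟩ :=
    exists_connector (h2 (v (q + 1))) (Q := C₁ ∪ C₂ ∪ {x | ∃ i < p, v i = x})
      (T := {x | ∃ j, (q + 1 < j ∧ j < m) ∧ v j = x})
      (by
        rw [Set.disjoint_left]
        rintro x hx ⟨j, hj, rfl⟩
        rcases hx with (hx | hx) | ⟨i, hi, h⟩
        · exact hq₁ j (by omega) hj.2 hx
        · exact hq₂ j (by omega) hj.2 hx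
        · exact hne i j (by omega) hj.2 (by omega) h)
      (a := a₁) (b := v (q + 2)) (Or.inl (Or.inl ha₁)) (fun h => hq₁ _ (by omega) hjm (h ▸ ha₁))
      ⟨q + 2, ⟨by omega, hqm⟩, rfl⟩ (hne _ _ (by omega) (by omega) (by omega))
  have hRq : ∀ l, q < l → l < m → v l ∉ R := by
    intro l hl hlm h
    rcases Nat.lt_or_ge (q + 1) l with hl' | hl'
    · exact hRT _ h ⟨l, ⟨hl', hlm⟩, rfl⟩
    · obtain rfl : l = q + 1 := by omega
      exact hcR h
  have hRp : ∀ l ≤ p, v l ∈ R → v l = w := by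
    intro l hl h
    refine hRQ _ h ?_
    rcases hl.lt_or_eq with hl | rfl
    · exact Or.inr ⟨l, hl, rfl⟩
    · exact Or.inl hvp
  by_cases hw₁ : w ∈ C₁
  · refine Linkage.of_adj hinj hpq hi hj.1 hj.2 ha' hC₂
      (induce_union_connected hC₁ hR ⟨w, hw₁, hw⟩).preconnected ?_ ha₂ (Or.inl ha₁) hz hzj (Or.inr hy)
      hyt hp₂ ?_ hq₂' ?_
    · rw [Set.disjoint_union_right]
      refine ⟨hd.symm, Set.disjoint_left.2 fun x hx hxR => ?_⟩
      obtain rfl := hRQ x hxR (Or.inl (Or.inr hx))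
      exact Set.disjoint_left.1 hd hw₁ hx
    · rintro l hl (h | h)
      · exact hp₁ l hl h
      · have := hRp l hl h
        rw [← this] at hw₁
        exact hp₁ l hl hw₁
    · rintro l hl hlm (h | h)
      · exact hq₁ l hl hlm h
      · exact hRq l hl hlm h
  by_cases hw₂ : w ∈ C₂
  · refine Linkage.of_adj hinj hpq hi hj.1 hj.2 ha hC₁
      (induce_union_connected hC₂ hR ⟨w, hw₂, hw⟩).preconnected ?_ ha₁ (Or.inl ha₂) hq
      (hadj q (by omega)) (Or.inr hy) hyt hp₁ ?_ hq₁ ?_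
    · rw [Set.disjoint_union_right]
      refine ⟨hd, Set.disjoint_left.2 fun x hx hxR => ?_⟩
      obtain rfl := hRQ x hxR (Or.inl (Or.inl hx))
      exact Set.disjoint_left.1 hd hx hw₂
    · rintro l hl (h | h)
      · exact hp₂ l hl h
      · have := hRp l hl h
        rw [← this] at hw₂
        exact hp₂ l hl hw₂
    · rintro l hl hlm (h | h)
      · exact hq₂' l hl hlm h
      · exact hRq l hl hlm h
  obtain ⟨e, he, rfl⟩ : ∃ i < p, v i = w := by
    rcases hwQ with (h | h) | h
    · exact absurd h hw₁
    · exact absurd h hw₂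
    · exact h
  have hR₁ : Disjoint C₁ R := by
    refine Set.disjoint_left.2 fun x hx hxR => ?_
    obtain rfl := hRQ x hxR (Or.inl (Or.inl hx))
    exact hw₁ hx
  have hR₂ : Disjoint C₂ R := by
    refine Set.disjoint_left.2 fun x hx hxR => ?_
    obtain rfl := hRQ x hxR (Or.inl (Or.inr hx))
    exact hw₂ hx
  rcases ha with ⟨rfl, -⟩ | ⟨-, rfl⟩
  · exact Linkage.of_adj hinj hpq he hj.1 hj.2 (Or.inl ⟨rfl, rfl⟩) hC₁ hR hR₁ ha₁ hw hq
      (hadj q (by omega)) hy hyt hp₁ hRp hq₁ hRq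
  · exact Linkage.of_adj hinj hpq he hj.1 hj.2 (Or.inl ⟨rfl, rfl⟩) hC₂ hR hR₂ ha₂ hw hz hzj hy hyt hp₂
      hRp hq₂' hRq

theorem linkage_of_le (hinj : Set.InjOn v (Set.Iio m))
    (hadj : ∀ i, i + 1 < m → G.Adj (v i) (v (i + 1)))
    (h2 : ∀ c, (G.induce ({c}ᶜ : Set V)).Preconnected) (hp : 0 < p) (hpq : p ≤ q) (hqm : q + 1 < m) :
    Linkage G v m p q := by
  induction q, hpq using Nat.le_induction with
  | base => exact Linkage.base hinj h2 hp hqm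
  | succ q hpq ih => exact (ih (by omega)).succ hinj hadj h2 hpq (by omega)

end SimpleGraph

/-! ### Long cycles from the degrees of the ends of a path. -/

namespace SimpleGraph

variable {V : Type*} {G : SimpleGraph V} {v : ℕ → V} {m : ℕ}

open Finset in
/-- Crossing chords from the ends of a path give a long cycle. -/
theorem hasCycleAtLeast_of_crossing [DecidableEq V] (hinj : Set.InjOn v (Set.Iio m))
    (hadj : ∀ i, i + 1 < m → G.Adj (v i) (v (i + 1))) {k : ℕ} (hk : 3 ≤ k) (hkm : k ≤ m)
    {I J : Finset ℕ} (hI : ∀ i, i ∈ I ↔ i < m ∧ G.Adj (v 0) (v i))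
    (hJ : ∀ i, i ∈ J ↔ i < m ∧ G.Adj (v (m - 1)) (v i)) (hI' : m - 1 ∉ I)
    (hkIJ : k ≤ I.card + J.card) (hcr : ∃ i ∈ J, ∃ j ∈ I, i < j) : HasCycleAtLeast G k := by
  obtain ⟨i₀, hi₀, j₀, hj₀, hij₀⟩ := hcr
  -- The cycle made from a crossing pair misses only the vertices strictly between `i` and `j`, so
  -- the gap is taken minimal.
  obtain ⟨⟨i, j⟩, hij, hmin⟩ := Finset.exists_min_image ((J ×ˢ I).filter fun e => e.1 < e.2)
    (fun e => e.2 - e.1) ⟨(i₀, j₀), by simp [hi₀, hj₀, hij₀]⟩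
  simp only [mem_filter, mem_product, and_imp, Prod.forall] at hij hmin
  obtain ⟨⟨hi, hj⟩, hij⟩ := hij
  have hjm := ((hI j).1 hj).1
  have hdis : Disjoint ((Icc 0 i).image v) ((Icc j (m - 1)).image v) := by
    rw [Finset.disjoint_left]
    simp only [mem_image, mem_Icc]
    rintro _ ⟨x, hx, rfl⟩ ⟨y, hy, he⟩
    have := hinj (Set.mem_Iio.2 (by omega)) (Set.mem_Iio.2 (by omega)) he
    omega
  have hpath := (pathOn_image_Icc hinj hadj (show j ≤ m - 1 by omega) (by omega)).join
    (pathOn_image_Icc hinj hadj (Nat.zero_le i) (by omega)).symm ((hJ i).1 hi).2 hdis.symm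
  have hcard : ((Icc j (m - 1)).image v ∪ (Icc 0 i).image v).card = (m - j) + (i + 1) := by
    rw [card_union_of_disjoint hdis.symm, card_image_of_injOn, card_image_of_injOn, Nat.card_Icc,
      Nat.card_Icc]
    · omega
    · exact hinj.mono fun x hx => Set.mem_Iio.2 (by rw [mem_coe, mem_Icc] at hx; omega)
    · exact hinj.mono fun x hx => Set.mem_Iio.2 (by rw [mem_coe, mem_Icc] at hx; omega)
  suffices hle : k ≤ (m - j) + (i + 1) from
    hpath.hasCycleAtLeast ((hI j).1 hj).2.symm (by omega) (by omega)
  rcases Nat.lt_or_ge (i + 1) j with hlt | hge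
  · have h0I : 0 ∉ I := fun h => ((hI 0).1 h).2.ne rfl
    have hmJ : m - 1 ∉ J := fun h => ((hJ _).1 h).2.ne rfl
    have hcI : (I.image (· - 1)).card = I.card := by
      refine card_image_of_injOn fun x hx y hy hxy => ?_
      have hx0 : x ≠ 0 := fun h => h0I (h ▸ hx)
      have hy0 : y ≠ 0 := fun h => h0I (h ▸ hy)
      change x - 1 = y - 1 at hxy
      omega
    -- A common element would be a crossing pair of gap one. Thus `I` shifted by one and `J` are
    -- disjoint, and by minimality both avoid the gap; the intervals in `hsub` have together as many
    -- elements as the cycle has vertices.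
    have hd : Disjoint (I.image (· - 1)) J := by
      rw [Finset.disjoint_left]
      intro x hx hxJ
      obtain ⟨y, hy, rfl⟩ := mem_image.1 hx
      have hy0 : y ≠ 0 := fun h => h0I (h ▸ hy)
      have := hmin _ _ hxJ hy (by omega)
      omega
    have hsub : I.image (· - 1) ∪ J ⊆ Icc 0 i ∪ Icc (j - 1) (m - 2) := by
      intro x hx
      rw [mem_union, mem_Icc, mem_Icc]
      rcases mem_union.1 hx with hx | hx
      · obtain ⟨y, hy, rfl⟩ := mem_image.1 hx
        have hym : y ≠ m - 1 := fun h => hI' (h ▸ hy)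
        have hy' := ((hI y).1 hy).1
        by_contra hcon
        have := hmin _ _ hi hy (by omega)
        omega
      · have hxm : x ≠ m - 1 := fun h => hmJ (h ▸ hx)
        have hx' := ((hJ x).1 hx).1
        by_contra hcon
        have := hmin _ _ hx hj (by omega)
        omega
    have h1 := card_le_card hsub
    have h2 := card_union_le (Icc 0 i) (Icc (j - 1) (m - 2))
    rw [card_union_of_disjoint hd, hcI] at h1
    rw [Nat.card_Icc, Nat.card_Icc] at h2
    have hjm' : j ≠ m - 1 := fun h => hI' (h ▸ hj)
    omega
  · omega

open Finset in
/-- If no chords from the two ends of a path cross, then there is a cycle through both ends and all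
their neighbours on the path. -/
theorem hasCycleAtLeast_of_not_crossing [DecidableEq V] (hinj : Set.InjOn v (Set.Iio m))
    (hadj : ∀ i, i + 1 < m → G.Adj (v i) (v (i + 1)))
    (h2 : ∀ c, (G.induce ({c}ᶜ : Set V)).Preconnected) {k : ℕ} (hk : 3 ≤ k) (hkm : k ≤ m)
    {I J : Finset ℕ} (hI : ∀ i, i ∈ I ↔ i < m ∧ G.Adj (v 0) (v i))
    (hJ : ∀ i, i ∈ J ↔ i < m ∧ G.Adj (v (m - 1)) (v i))
    (hkIJ : k ≤ I.card + J.card) (hcr : ∀ i ∈ J, ∀ j ∈ I, j ≤ i) : HasCycleAtLeast G k := by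
  have h1I : 1 ∈ I := (hI 1).2 ⟨by omega, hadj 0 (by omega)⟩
  have h0I : 0 ∉ I := fun h => ((hI 0).1 h).2.ne rfl
  have hmJ : m - 1 ∉ J := fun h => ((hJ _).1 h).2.ne rfl
  have h2J : m - 2 ∈ J := by
    refine (hJ _).2 ⟨by omega, ?_⟩
    have := hadj (m - 2) (by omega)
    rw [show m - 2 + 1 = m - 1 by omega] at this
    exact this.symm
  obtain ⟨p, hpI, hp⟩ : ∃ p ∈ I, ∀ l ∈ I, l ≤ p := ⟨_, I.max'_mem ⟨_, h1I⟩, fun l => I.le_max' l⟩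
  obtain ⟨q, hqJ, hq⟩ : ∃ q ∈ J, ∀ l ∈ J, q ≤ l := ⟨_, J.min'_mem ⟨_, h2J⟩, fun l => J.min'_le l⟩
  have hpq := hcr q hqJ p hpI
  have hqm := hq _ h2J
  have hp1 := hp _ h1I
  obtain ⟨i, j, a₁, a₂, C₁, C₂, hi, hj, hjm, ha, hC₁, hC₂, hd, ha₁, ha₂, hqC, ⟨z, hz, hzj⟩, hp₁, hp₂,
    hq₁, hq₂⟩ := linkage_of_le hinj hadj h2 (by omega) hpq (by omega)
  -- The route v p, …, v l, v 0, …, v i skips only indices between `i` and `l`, so it contains every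
  -- neighbour of `v 0` on the path. The index `r` does the same for the other end.
  obtain ⟨l, ⟨hlI, hil⟩, hl⟩ : ∃ l, (l ∈ I ∧ i < l) ∧ ∀ l' ∈ I, i < l' → l ≤ l' := by
    have hne : (I.filter (i < ·)).Nonempty := ⟨p, by simp [hpI, hi]⟩
    refine ⟨_, mem_filter.1 (min'_mem _ hne), fun l' h h' => min'_le _ _ (mem_filter.2 ⟨h, h'⟩)⟩
  obtain ⟨r, ⟨hrJ, hrj⟩, hr⟩ : ∃ r, (r ∈ J ∧ r < j) ∧ ∀ l' ∈ J, l' < j → l' ≤ r := by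
    have hne : (J.filter (· < j)).Nonempty := ⟨q, by simp [hqJ, hj]⟩
    exact ⟨(J.filter (· < j)).max' hne, mem_filter.1 ((J.filter (· < j)).max'_mem hne), fun l' h h' =>
      (J.filter (· < j)).le_max' _ (mem_filter.2 ⟨h, h'⟩)⟩
  have hlp := hp l hlI
  have hqr := hq r hrJ
  have hAd : Disjoint ((Icc l p).image v) ((Icc 0 i).image v) := by
    rw [Finset.disjoint_left]
    simp only [mem_image, mem_Icc]
    rintro _ ⟨x, hx, rfl⟩ ⟨y, hy, he⟩
    have := hinj (Set.mem_Iio.2 (by omega)) (Set.mem_Iio.2 (by omega)) he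
    omega
  have hBd : Disjoint ((Icc q r).image v) ((Icc j (m - 1)).image v) := by
    rw [Finset.disjoint_left]
    simp only [mem_image, mem_Icc]
    rintro _ ⟨x, hx, rfl⟩ ⟨y, hy, he⟩
    have := hinj (Set.mem_Iio.2 (by omega)) (Set.mem_Iio.2 (by omega)) he
    omega
  have hA : G.PathOn (v p) (v i) ((Icc l p ∪ Icc 0 i).image v) := by
    rw [image_union]
    exact (pathOn_image_Icc hinj hadj hlp (by omega)).symm.join
      (pathOn_image_Icc hinj hadj (Nat.zero_le i) (by omega)) ((hI l).1 hlI).2.symm hAd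
  have hB : G.PathOn (v q) (v j) ((Icc q r ∪ Icc j (m - 1)).image v) := by
    rw [image_union]
    exact (pathOn_image_Icc hinj hadj hqr (by omega)).join
      (pathOn_image_Icc hinj hadj (show j ≤ m - 1 by omega) (by omega)).symm
      ((hJ r).1 hrJ).2.symm hBd
  have hA' : G.PathOn a₂ a₁ ((Icc l p ∪ Icc 0 i).image v) := by
    rcases ha with ⟨rfl, rfl⟩ | ⟨rfl, rfl⟩
    · exact hA.symm
    · exact hA
  have hAp : ∀ x ∈ (Icc l p ∪ Icc 0 i).image v, ∃ e ≤ p, v e = x := by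
    simp only [mem_image, mem_union, mem_Icc]
    rintro _ ⟨e, he, rfl⟩
    exact ⟨e, by omega, rfl⟩
  have hBq : ∀ x ∈ (Icc q r ∪ Icc j (m - 1)).image v, ∃ e, q ≤ e ∧ e < m ∧ v e = x := by
    simp only [mem_image, mem_union, mem_Icc]
    rintro _ ⟨e, he, rfl⟩
    exact ⟨e, by omega, by omega, rfl⟩
  obtain ⟨Sα, hα, hαC⟩ := exists_pathOn_of_preconnected_induce hC₁ ha₁ hqC
  obtain ⟨Sβ, hβ, hβC⟩ := exists_pathOn_of_preconnected_induce hC₂ hz ha₂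
  -- Go through `C₂` to the initial segment, around it, through `C₁` to `v q`, and around the final
  -- segment to `v j`; the edge from `z` to `v j` closes the cycle.
  have hc := ((hβ.append hA' (by
      intro x hx hx'
      obtain ⟨e, he, rfl⟩ := hAp x hx'
      exact hp₂ e he (hβC hx))).append hα (by
      intro x hx hx'
      rcases mem_union.1 hx with hx | hx
      · exact absurd (hαC hx') (Set.disjoint_right.1 hd (hβC hx))
      · obtain ⟨e, he, rfl⟩ := hAp x hx
        exact hp₁ e he (hαC hx'))).append hB (by
      intro x hx hx'
      obtain ⟨e, he, hem, rfl⟩ := hBq x hx'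
      rw [mem_union, mem_union] at hx
      rcases hx with (hx | hx) | hx
      · exact absurd (hβC hx) (hq₂ e he hem)
      · obtain ⟨e', he', h⟩ := hAp _ hx
        have := hinj (Set.mem_Iio.2 (by omega)) (Set.mem_Iio.2 hem) h
        congr 1
        omega
      · rcases he.lt_or_eq with he | rfl
        · exact absurd (hαC hx) (hq₁ e he hem)
        · rfl)
  have hsub : (insert 0 I ∪ J).image v ⊆ Sβ ∪ (Icc l p ∪ Icc 0 i).image v ∪ Sα ∪
      (Icc q r ∪ Icc j (m - 1)).image v := by
    have h1 : insert 0 I ⊆ Icc l p ∪ Icc 0 i := by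
      intro x hx
      rw [mem_insert] at hx
      rw [mem_union, mem_Icc, mem_Icc]
      rcases hx with rfl | hx
      · omega
      · have := hp x hx
        have := hl x hx
        omega
    have h2 : J ⊆ Icc q r ∪ Icc j (m - 1) := by
      intro x hx
      rw [mem_union, mem_Icc, mem_Icc]
      have := hq x hx
      have := hr x hx
      have := ((hJ x).1 hx).1
      omega
    rw [image_union]
    refine union_subset_union (fun x hx => ?_) (image_subset_image h2)
    exact mem_union_left _ (mem_union_right _ (image_subset_image h1 hx))
  have hcard := card_le_card hsub
  rw [card_image_of_injOn] at hcard
  · have h3 := card_union_add_card_inter (insert 0 I) J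
    rw [card_insert_of_notMem h0I] at h3
    -- Without crossings only one index can be shared, and the extra vertex `v 0` makes up for it.
    have h4 : (insert 0 I ∩ J).card ≤ 1 := by
      rw [card_le_one]
      intro x hx y hy
      rw [mem_inter, mem_insert] at hx hy
      have h0J : 0 ∉ J := fun h => by
        have := hcr 0 h 1 h1I
        omega
      have hx1 : x ∈ I := hx.1.resolve_left fun h => h0J (h ▸ hx.2)
      have hy1 : y ∈ I := hy.1.resolve_left fun h => h0J (h ▸ hy.2)
      exact le_antisymm (hcr y hy.2 x hx1) (hcr x hx.2 y hy1)
    exact hc.hasCycleAtLeast hzj (by omega) (by omega)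
  · refine hinj.mono fun x hx => ?_
    rw [mem_coe, mem_union, mem_insert] at hx
    rcases hx with (rfl | hx) | hx
    · exact Set.mem_Iio.2 (by omega)
    · exact ((hI x).1 hx).1
    · exact ((hJ x).1 hx).1

/-- In a graph without cut vertices, a path `S` with nonadjacent ends `x` and `y` gives a cycle of
length at least `min |S| (d_S(x) + d_S(y))`. -/
theorem PathOn.hasCycleAtLeast_of_degree [DecidableEq V] [DecidableRel G.Adj]
    (h2 : ∀ c, (G.induce ({c}ᶜ : Set V)).Preconnected) {k : ℕ} (hk : 3 ≤ k) {x y : V} {S : Finset V}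
    (hS : G.PathOn x y S) (hkS : k ≤ S.card) (hxy : ¬ G.Adj x y)
    (hdeg : k ≤ (S.filter (G.Adj x)).card + (S.filter (G.Adj y)).card) : HasCycleAtLeast G k := by
  obtain ⟨v, hinj, hadj, h0, hm, himg⟩ := hS.exists_enum
  have hcard : ∀ z, ((Finset.range S.card).filter fun i => G.Adj z (v i)).card =
      (S.filter (G.Adj z)).card := by
    intro z
    conv_rhs => rw [← himg, Finset.filter_image]
    rw [Finset.card_image_of_injOn]
    exact hinj.mono fun i hi => by simpa using (Finset.mem_filter.1 hi).1
  rw [← hcard x, ← hcard y, ← h0, ← hm] at hdeg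
  have hI' : S.card - 1 ∉ (Finset.range S.card).filter fun i => G.Adj (v 0) (v i) := by
    rw [Finset.mem_filter, h0, hm]
    exact fun h => hxy h.2
  by_cases hcr : ∃ i ∈ (Finset.range S.card).filter fun i => G.Adj (v (S.card - 1)) (v i),
      ∃ j ∈ (Finset.range S.card).filter fun i => G.Adj (v 0) (v i), i < j
  · exact hasCycleAtLeast_of_crossing hinj hadj hk hkS (by simp) (by simp) hI' hdeg hcr
  · push Not at hcr
    exact hasCycleAtLeast_of_not_crossing hinj hadj h2 hk hkS (by simp) (by simp) hdeg hcr

end SimpleGraph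

/-! ### Edge-maximal graphs and Kopylov's theorem. -/

namespace SimpleGraph

variable {V : Type*} {G : SimpleGraph V}

section AddEdge

variable [DecidableEq V] {a b u v : V} {S : Finset V}

omit [DecidableEq V] in
theorem PathOn.eq_singleton (h : G.PathOn a a S) : S = {a} := by
  obtain ⟨p, hp, hS⟩ := h
  ext x
  rw [← hS x]
  cases p with
  | nil => simp
  | cons h q =>
    rw [Walk.cons_isPath_iff] at hp
    exact absurd q.end_mem_support hp.2

theorem PathOn.of_sup_edge (h : (G ⊔ edge u v).PathOn a b S) :
    G.PathOn a b S ∨ ∃ S₁ S₂, Disjoint S₁ S₂ ∧ S = S₁ ∪ S₂ ∧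
      ((G.PathOn a u S₁ ∧ G.PathOn v b S₂) ∨ (G.PathOn a v S₁ ∧ G.PathOn u b S₂)) := by
  obtain ⟨p, hp, hS⟩ := h
  induction p generalizing S with
  | @nil a =>
    left
    have : S = {a} := by
      ext x
      rw [← hS x]
      simp
    rw [this]
    exact PathOn.refl a
  | @cons a c b hac p ih =>
    rw [Walk.cons_isPath_iff] at hp
    have haS : a ∉ p.support.toFinset := by simpa using hp.2
    obtain rfl : insert a p.support.toFinset = S := by
      ext x
      rw [← hS x]
      simp
    rw [sup_adj, edge_adj] at hac
    rcases ih hp.1 (S := p.support.toFinset) (by simp) with h | ⟨S₁, S₂, hd, hSS, h⟩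
    · rcases hac with hac | ⟨⟨rfl, rfl⟩ | ⟨rfl, rfl⟩, -⟩
      · exact Or.inl (h.cons hac haS)
      · exact Or.inr ⟨{a}, _, Finset.disjoint_singleton_left.2 haS, Finset.insert_eq _ _,
          Or.inl ⟨PathOn.refl _, h⟩⟩
      · exact Or.inr ⟨{a}, _, Finset.disjoint_singleton_left.2 haS, Finset.insert_eq _ _,
          Or.inr ⟨PathOn.refl _, h⟩⟩
    · rw [hSS, Finset.mem_union, not_or] at haS
      rcases hac with hac | hac
      · right
        refine ⟨insert a S₁, S₂, ?_, ?_, ?_⟩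
        · rw [Finset.disjoint_insert_left]
          exact ⟨haS.2, hd⟩
        · rw [hSS, Finset.insert_union]
        · exact h.imp (fun h => ⟨h.1.cons hac haS.1, h.2⟩) fun h => ⟨h.1.cons hac haS.1, h.2⟩
      · exfalso
        rcases hac with ⟨⟨rfl, rfl⟩ | ⟨rfl, rfl⟩, -⟩
        · rcases h with h | h
          · exact haS.1 h.1.end_mem
          · exact haS.2 h.2.start_mem
        · rcases h with h | h
          · exact haS.2 h.2.start_mem
          · exact haS.1 h.1.end_mem

theorem PathOn.of_cycle_through_edge {S₁ S₂ : Finset V} (h₁ : G.PathOn a u S₁)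
    (h₂ : G.PathOn v b S₂) (hd : Disjoint S₁ S₂) (hab : (G ⊔ edge u v).Adj a b)
    (h3 : 3 ≤ (S₁ ∪ S₂).card) : G.PathOn u v (S₁ ∪ S₂) := by
  rw [sup_adj, edge_adj] at hab
  rcases hab with hab | ⟨⟨rfl, rfl⟩ | ⟨rfl, rfl⟩, -⟩
  · exact h₁.symm.join h₂.symm hab hd
  -- The closing edge is `uv` itself, so both pieces are single vertices.
  · rw [h₁.eq_singleton, h₂.eq_singleton] at h3
    have := Finset.card_union_le {a} {b}
    simp only [Finset.card_singleton] at this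
    omega
  · exact absurd h₂.start_mem (Finset.disjoint_left.1 hd h₁.start_mem)

/-- If adding the edge `uv` creates a long cycle, then `u` and `v` are joined by a long path. -/
theorem exists_pathOn_of_hasCycleAtLeast_sup_edge {k : ℕ} (hG : ¬ HasCycleAtLeast G k)
    (h : HasCycleAtLeast (G ⊔ edge u v) k) : ∃ S, G.PathOn u v S ∧ k ≤ S.card := by
  obtain ⟨a, b, S, hS, hab, h3, hk⟩ := h.exists_pathOn
  rcases hS.of_sup_edge with hp | ⟨S₁, S₂, hd, rfl, hp⟩
  · rw [sup_adj, edge_adj] at hab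
    rcases hab with hab | ⟨⟨rfl, rfl⟩ | ⟨rfl, rfl⟩, -⟩
    · exact absurd (hp.hasCycleAtLeast hab h3 hk) hG
    · exact ⟨S, hp, hk⟩
    · exact ⟨S, hp.symm, hk⟩
  · refine ⟨S₁ ∪ S₂, ?_, hk⟩
    rcases hp with hp | hp
    · exact hp.1.of_cycle_through_edge hp.2 hd hab h3
    · rw [edge_comm] at hab
      exact (hp.1.of_cycle_through_edge hp.2 hd hab h3).symm

end AddEdge

theorem exists_adj_ne_of_preconnected [Fintype V] (h3 : 3 ≤ Fintype.card V) {u c : V}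
    (hc : (G.induce ({c}ᶜ : Set V)).Preconnected) (hu : u ≠ c) : ∃ w, G.Adj u w ∧ w ≠ c := by
  classical
  obtain ⟨z, hz⟩ : ∃ z, z ∉ ({u, c} : Finset V) := by
    by_contra! h
    have h1 : (Finset.univ : Finset V).card ≤ ({u, c} : Finset V).card :=
      Finset.card_le_card fun x _ => h x
    have := Finset.card_le_two (a := u) (b := c)
    rw [Finset.card_univ] at h1
    omega
  simp only [Finset.mem_insert, Finset.mem_singleton, not_or] at hz
  obtain ⟨p⟩ := hc ⟨u, hu⟩ ⟨z, hz.2⟩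
  cases p with
  | nil => exact absurd rfl hz.1
  | @cons _ w _ h q => exact ⟨w, h, w.2⟩

theorem IsClique.exists_pathOn [DecidableEq V] {H : Finset V} (hH : G.IsClique (H : Set V)) {a : V}
    (ha : a ∈ H) : ∃ b, G.PathOn a b H := by
  induction H using Finset.strongInduction generalizing a with
  | H H ih =>
    rcases (H.erase a).eq_empty_or_nonempty with h | ⟨c, hc⟩
    · refine ⟨a, ?_⟩
      rw [Finset.erase_eq_empty_iff] at h
      rcases h with h | h
      · simp [h] at ha
      · rw [h]
        exact PathOn.refl a
    · obtain ⟨b, hb⟩ := ih _ (Finset.erase_ssubset ha) (hH.subset (by simp)) hc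
      refine ⟨b, ?_⟩
      have := hb.cons (hH ha (Finset.mem_of_mem_erase hc) (Finset.ne_of_mem_erase hc).symm) (by simp)
      rwa [Finset.insert_erase ha] at this

theorem IsClique.hasCycleAtLeast {H : Finset V} (hH : G.IsClique (H : Set V)) {k : ℕ}
    (h3 : 3 ≤ H.card) (hk : k ≤ H.card) : HasCycleAtLeast G k := by
  classical
  obtain ⟨a, ha⟩ := Finset.card_pos.1 (show 0 < H.card by omega)
  obtain ⟨b, hb⟩ := hH.exists_pathOn ha
  refine hb.hasCycleAtLeast (hH ha hb.end_mem ?_) h3 hk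
  rintro rfl
  rw [hb.eq_singleton] at h3
  simp at h3

open Classical in
/-- Every set of more than `r` vertices contains a vertex with at most `s` neighbours in the set. -/
def IsDegenerateAbove (G : SimpleGraph V) (r s : ℕ) : Prop :=
  ∀ U : Finset V, r < U.card → ∃ u ∈ U, (U.filter (G.Adj u)).card ≤ s

theorem IsDegenerateAbove.anti {G' : SimpleGraph V} {r s : ℕ} (hG : G ≤ G')
    (h : IsDegenerateAbove G' r s) : IsDegenerateAbove G r s := by
  classical
  intro U hU
  obtain ⟨u, hu, hs⟩ := h U hU
  refine ⟨u, hu, le_trans (Finset.card_le_card fun x hx => ?_) hs⟩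
  rw [Finset.mem_filter] at hx ⊢
  exact ⟨hx.1, hG hx.2⟩

section Core

variable [Fintype V] {k : ℕ}

open Classical in
/-- If nonadjacent vertices are always joined by paths on at least `k` vertices, but there is no
cycle of length at least `k`, then vertex sets of large minimum degree are completely joined. -/
theorem adj_of_degree_le (h2 : ∀ c, (G.induce ({c}ᶜ : Set V)).Preconnected) (hk : 3 ≤ k)
    (hG : ¬ HasCycleAtLeast G k)
    (hmax : ∀ x y, x ≠ y → ¬ G.Adj x y → ∃ S, G.PathOn x y S ∧ k ≤ S.card) {A B : Finset V} {a b : ℕ}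
    (hA : ∀ x ∈ A, a ≤ (A.filter (G.Adj x)).card) (hB : ∀ y ∈ B, b ≤ (B.filter (G.Adj y)).card)
    (hab : k ≤ a + b) {x y : V} (hx : x ∈ A) (hy : y ∈ B) (hxy : x ≠ y) : G.Adj x y := by
  by_contra hadj
  -- Among all nonadjacent pairs from `A × B`, take one joined by a longest path. A neighbour of `x`
  -- in `A` off this path would either close a long cycle at `y` or start a longer path of the same
  -- kind; hence all neighbours of `x` in `A` lie on the path, and likewise for `y` in `B`.
  let P : ℕ → Prop := fun n => ∃ x ∈ A, ∃ y ∈ B, x ≠ y ∧ ¬ G.Adj x y ∧ ∃ S, G.PathOn x y S ∧ S.card = n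
  obtain ⟨S₀, hS₀, hkS₀⟩ := hmax x y hxy hadj
  have hP₀ : P S₀.card := ⟨x, hx, y, hy, hxy, hadj, S₀, hS₀, rfl⟩
  have hspec := Nat.findGreatest_spec (S₀.card_le_univ) hP₀
  have hge : k ≤ Nat.findGreatest P (Fintype.card V) :=
    hkS₀.trans (Nat.le_findGreatest S₀.card_le_univ hP₀)
  obtain ⟨x, hx, y, hy, hxy, hadj, S, hS, hSc⟩ := hspec
  have hmaxS : ∀ x ∈ A, ∀ y ∈ B, x ≠ y → ¬ G.Adj x y → ∀ T, G.PathOn x y T → T.card ≤ S.card := by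
    intro x hx y hy hxy hadj T hT
    rw [hSc]
    exact Nat.le_findGreatest T.card_le_univ ⟨x, hx, y, hy, hxy, hadj, T, hT, rfl⟩
  rw [← hSc] at hge
  have hcl : ∀ z w T, G.PathOn z w T → G.Adj z w → k ≤ T.card → False := fun z w T hT hzw hkT =>
    hG (hT.hasCycleAtLeast hzw (hk.trans hkT) hkT)
  refine hG (hS.hasCycleAtLeast_of_degree h2 hk hge hadj (hab.trans (Nat.add_le_add
    ((hA x hx).trans (Finset.card_le_card ?_)) ((hB y hy).trans (Finset.card_le_card ?_)))))
  · intro z hz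
    rw [Finset.mem_filter] at hz ⊢
    refine ⟨by_contra fun hzS => ?_, hz.2⟩
    have hp := hS.cons hz.2.symm hzS
    have hc := Finset.card_insert_of_notMem hzS
    by_cases hzy : G.Adj z y
    · exact hcl _ _ _ hp hzy (by omega)
    · have := hmaxS z hz.1 y hy (fun h => hzS (h ▸ hS.end_mem)) hzy _ hp
      omega
  · intro z hz
    rw [Finset.mem_filter] at hz ⊢
    refine ⟨by_contra fun hzS => ?_, hz.2⟩
    have hp := (hS.symm.cons hz.2.symm hzS).symm
    have hc := Finset.card_insert_of_notMem hzS
    by_cases hxz : G.Adj x z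
    · exact hcl _ _ _ hp hxz (by omega)
    · have := hmaxS x hx z hz.1 (fun h => hzS (h ▸ hS.start_mem)) hxz _ hp
      omega

-- If the condition fails for t = (k-1)/2, let `H` be a largest witness. As 2(t+1) ≥ k, `H` is a
-- clique, and by maximality no outside vertex is adjacent to all of `H`. Then s = k - |H| works: a
-- witness `U` against it has more vertices than `H` and minimum degree at least k - |H| + 1, while
-- degrees in `H` are |H| - 1. These add up to k, so a vertex of `U` outside `H` would be adjacent
-- to all of `H`.
open Classical in
theorem exists_isDegenerateAbove_of_maximal (h2 : ∀ c, (G.induce ({c}ᶜ : Set V)).Preconnected)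
    (hk : 5 ≤ k) (hkV : k ≤ Fintype.card V) (hG : ¬ HasCycleAtLeast G k)
    (hmax : ∀ x y, x ≠ y → ¬ G.Adj x y → ∃ S, G.PathOn x y S ∧ k ≤ S.card) :
    ∃ s, 2 ≤ s ∧ s ≤ (k - 1) / 2 ∧ G.IsDegenerateAbove (k - s) s := by
  set t := (k - 1) / 2 with ht
  by_cases hD : G.IsDegenerateAbove (k - t) t
  · exact ⟨t, by omega, le_rfl, hD⟩
  have key := fun {A B : Finset V} {a b : ℕ} => adj_of_degree_le h2 (by omega) hG hmax (A := A)
    (B := B) (a := a) (b := b)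
  simp only [IsDegenerateAbove, not_forall, not_exists, not_and, not_le] at hD
  obtain ⟨U₀, hU₀, hU₀'⟩ := hD
  obtain ⟨H, hH, hHmax⟩ := Finset.exists_max_image (Finset.univ.filter fun U : Finset V =>
    k - t < U.card ∧ ∀ u ∈ U, t + 1 ≤ (U.filter (G.Adj u)).card) Finset.card
    ⟨U₀, by simpa using ⟨hU₀, fun u hu => hU₀' u hu⟩⟩
  simp only [Finset.mem_filter, Finset.mem_univ, true_and, and_imp] at hH hHmax
  obtain ⟨hHc, hHdeg⟩ := hH
  have hclique : G.IsClique (H : Set V) := fun x hx y hy hxy =>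
    key hHdeg hHdeg (by omega) hx hy hxy
  have hdeg : ∀ x ∈ H, H.card - 1 ≤ (H.filter (G.Adj x)).card := by
    intro x hx
    rw [← Finset.card_erase_of_mem hx]
    refine Finset.card_le_card fun y hy => ?_
    rw [Finset.mem_erase] at hy
    exact Finset.mem_filter.2 ⟨hy.2, hclique hx hy.2 hy.1.symm⟩
  have hext : ∀ y ∉ H, ¬ ∀ x ∈ H, G.Adj x y := by
    intro y hy hall
    have := hHmax (insert y H) (by rw [Finset.card_insert_of_notMem hy]; omega) (by
      intro u hu
      rcases Finset.mem_insert.1 hu with rfl | hu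
      · refine le_trans (show t + 1 ≤ H.card by omega) (Finset.card_le_card fun x hx => ?_)
        exact Finset.mem_filter.2 ⟨Finset.mem_insert_of_mem hx, (hall x hx).symm⟩
      · exact (hHdeg u hu).trans (Finset.card_le_card
          (Finset.filter_subset_filter _ (Finset.subset_insert _ _))))
    rw [Finset.card_insert_of_notMem hy] at this
    omega
  have hlt : H.card < k := by
    by_contra! h
    exact hG (hclique.hasCycleAtLeast (by omega) h)
  have hlt' : H.card + 1 < k := by
    by_contra! h
    obtain ⟨y, hy⟩ : ∃ y, y ∉ H := by
      by_contra! hall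
      have := Finset.card_le_card (fun x _ => hall x : Finset.univ ⊆ H)
      rw [Finset.card_univ] at this
      omega
    -- If |H| = k - 1, degree 2, which every vertex has in the absence of cut vertices, already
    -- completes the sum to k. This is what gives s ≥ 2.
    refine hext y hy fun x hx => key (B := Finset.univ) (b := 2) hdeg (fun z _ => ?_) (by omega) hx
      (Finset.mem_univ y) (fun h => hy (h ▸ hx))
    have : Nontrivial V := Fintype.one_lt_card_iff_nontrivial.1 (by omega)
    obtain ⟨c, hc⟩ := exists_ne z
    obtain ⟨w₁, hw₁, -⟩ := exists_adj_ne_of_preconnected (by omega) (h2 c) hc.symm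
    obtain ⟨w₂, hw₂, hne⟩ := exists_adj_ne_of_preconnected (by omega) (h2 w₁) hw₁.ne
    rw [← Finset.card_pair hne]
    refine Finset.card_le_card fun w hw => ?_
    rw [Finset.mem_insert, Finset.mem_singleton] at hw
    rcases hw with rfl | rfl <;> simp [hw₁, hw₂]
  refine ⟨k - H.card, by omega, by omega, ?_⟩
  by_contra hD
  simp only [IsDegenerateAbove, not_forall, not_exists, not_and, not_le] at hD
  obtain ⟨U, hU, hU'⟩ := hD
  obtain ⟨y, hyU, hyH⟩ := Finset.exists_mem_notMem_of_card_lt_card (show H.card < U.card by omega)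
  exact hext y hyH fun x hx => key hdeg (b := k - H.card + 1) hU' (by omega) hx hyU
    (fun h => hyH (h ▸ hx))

/-- **Kopylov's theorem**, structural form: a 2-connected graph without cycles of length at least
`k` is `s`-degenerate down to `k - s` vertices for some `2 ≤ s ≤ (k - 1) / 2`. -/
theorem exists_isDegenerateAbove (h2 : ∀ c, (G.induce ({c}ᶜ : Set V)).Preconnected)
    (hk : 5 ≤ k) (hkV : k ≤ Fintype.card V) (hG : ¬ HasCycleAtLeast G k) :
    ∃ s, 2 ≤ s ∧ s ≤ (k - 1) / 2 ∧ G.IsDegenerateAbove (k - s) s := by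
  classical
  -- Adding edges preserves the absence of cut vertices, and degeneracy passes back to subgraphs, so
  -- edge-maximality costs nothing.
  obtain ⟨G', hle, hmax⟩ := Finite.exists_le_maximal (p := fun H : SimpleGraph V =>
    ¬ HasCycleAtLeast H k) hG
  obtain ⟨s, hs, hst, hD⟩ := exists_isDegenerateAbove_of_maximal (G := G')
    (fun c => (h2 c).mono (comap_monotone _ hle)) hk hkV hmax.prop (by
      intro x y hxy hadj
      refine exists_pathOn_of_hasCycleAtLeast_sup_edge hmax.prop (by_contra fun h => hadj ?_)
      refine hmax.le_of_ge h le_sup_left ?_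
      rw [sup_adj, edge_adj]
      exact Or.inr ⟨Or.inl ⟨rfl, rfl⟩, hxy⟩)
  exact ⟨s, hs, hst, hD.anti hle⟩

end Core

end SimpleGraph

/-! ### Rayleigh quotients of adjacency matrices. -/

section Rayleigh

open Matrix

variable {V : Type*} [Fintype V] (G : SimpleGraph V)

theorem Matrix.IsHermitian.sum_dotProduct_eigenvectorBasis [DecidableEq V] {A : Matrix V V ℝ}
    (hA : A.IsHermitian) (x y : V → ℝ) :
    ∑ i, (x ⬝ᵥ (hA.eigenvectorBasis i).ofLp) * ((hA.eigenvectorBasis i).ofLp ⬝ᵥ y) = x ⬝ᵥ y := by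
  have h := hA.eigenvectorBasis.sum_inner_mul_inner (WithLp.toLp 2 x) (WithLp.toLp 2 y)
  simp only [EuclideanSpace.inner_eq_star_dotProduct, star_trivial] at h
  rw [dotProduct_comm x y, ← h]
  refine Finset.sum_congr rfl fun i _ => ?_
  rw [dotProduct_comm x, dotProduct_comm _ y]

theorem Matrix.IsHermitian.dotProduct_mulVec_self [DecidableEq V] {A : Matrix V V ℝ}
    (hA : A.IsHermitian) (x : V → ℝ) :
    x ⬝ᵥ A *ᵥ x = ∑ i, hA.eigenvalues i * (x ⬝ᵥ (hA.eigenvectorBasis i).ofLp) ^ 2 := by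
  rw [← hA.sum_dotProduct_eigenvectorBasis x]
  refine Finset.sum_congr rfl fun i _ => ?_
  have hT : Aᵀ = A := by rw [← conjTranspose_eq_transpose_of_trivial]; exact hA
  have : (hA.eigenvectorBasis i).ofLp ⬝ᵥ A *ᵥ x =
      hA.eigenvalues i * (x ⬝ᵥ (hA.eigenvectorBasis i).ofLp) := by
    rw [dotProduct_mulVec, ← mulVec_transpose, hT, hA.mulVec_eigenvectorBasis, smul_dotProduct,
      smul_eq_mul, dotProduct_comm]
  rw [this]
  ring

open Classical in
theorem abs_eigenvalues_le_graphSpectralRadius (i : V) :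
    |(isHermitian_adjMatrix_real G).eigenvalues i| ≤ graphSpectralRadius G :=
  le_ciSup (f := fun i => |(isHermitian_adjMatrix_real G).eigenvalues i|)
    (Set.finite_range _).bddAbove i

theorem dotProduct_mulVec_le_graphSpectralRadius [inst : DecidableRel G.Adj] (x : V → ℝ) :
    x ⬝ᵥ G.adjMatrix ℝ *ᵥ x ≤ graphSpectralRadius G * (x ⬝ᵥ x) := by
  classical
  obtain rfl : inst = fun a b => Classical.propDecidable _ := Subsingleton.elim _ _
  rw [(isHermitian_adjMatrix_real G).dotProduct_mulVec_self,
    ← (isHermitian_adjMatrix_real G).sum_dotProduct_eigenvectorBasis x x, Finset.mul_sum]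
  refine Finset.sum_le_sum fun i _ => ?_
  rw [dotProduct_comm _ x, ← pow_two]
  refine mul_le_mul_of_nonneg_right ((le_abs_self _).trans ?_) (sq_nonneg _)
  convert abs_eigenvalues_le_graphSpectralRadius G i

/-- A nonnegative vector whose Rayleigh quotient is at least the spectral radius. -/
theorem exists_nonneg_graphSpectralRadius_le [Nonempty V] [DecidableRel G.Adj] :
    ∃ x : V → ℝ, (∀ i, 0 ≤ x i) ∧ 0 < x ⬝ᵥ x ∧
      graphSpectralRadius G * (x ⬝ᵥ x) ≤ x ⬝ᵥ G.adjMatrix ℝ *ᵥ x := by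
  classical
  obtain ⟨i, hi⟩ := exists_eq_ciSup_of_finite
    (f := fun i => |(isHermitian_adjMatrix_real G).eigenvalues i|)
  have hi' : |(isHermitian_adjMatrix_real G).eigenvalues i| = graphSpectralRadius G := by
    rw [hi, graphSpectralRadius]
    congr!
  set hA := isHermitian_adjMatrix_real G with hAdef
  set y := (hA.eigenvectorBasis i).ofLp with hy
  have hyy : y ⬝ᵥ y = 1 := by
    have := hA.eigenvectorBasis.orthonormal.1 i
    have h2 := real_inner_self_eq_norm_sq (hA.eigenvectorBasis i)
    rw [this, EuclideanSpace.inner_eq_star_dotProduct, star_trivial] at h2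
    simpa using h2
  have hAy : y ⬝ᵥ G.adjMatrix ℝ *ᵥ y = hA.eigenvalues i := by
    rw [hy, hA.mulVec_eigenvectorBasis, dotProduct_smul, ← hy, hyy, smul_eq_mul, mul_one]
  have hxx : (fun j => |y j|) ⬝ᵥ (fun j => |y j|) = 1 := by
    rw [← hyy]
    simp [dotProduct]
  -- The matrix has nonnegative entries, so taking absolute values of an eigenvector can only raise
  -- the absolute value of the form; this covers a negative extremal eigenvalue too.
  refine ⟨fun j => |y j|, fun j => abs_nonneg _, by rw [hxx]; exact one_pos, ?_⟩
  rw [hxx, mul_one, ← hi', ← hAy]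
  simp only [dotProduct, mulVec, Finset.mul_sum]
  refine (Finset.abs_sum_le_sum_abs _ _).trans (Finset.sum_le_sum fun j _ => ?_)
  refine (Finset.abs_sum_le_sum_abs _ _).trans (Finset.sum_le_sum fun l _ => ?_)
  rw [abs_mul, abs_mul, SimpleGraph.adjMatrix_apply]
  split_ifs <;> simp

end Rayleigh

/-! ### Summation by parts. -/

section Abel

open Finset

/-- The free lower bound `c` drives the induction: the hypothesis is used with `c := x n`, and
nonnegativity of the full sum then lowers `x n` to `c`. Only `c = 0` is needed afterwards. -/
theorem Finset.sum_range_mul_ge_of_antitone {f x : ℕ → ℝ} (n : ℕ)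
    (hx : ∀ i j, i ≤ j → j < n → x j ≤ x i) (h0 : ∀ i < n, 0 ≤ x i)
    (hf : ∀ p ≤ n, 0 ≤ ∑ i ∈ range p, f i) {c : ℝ} (hc : ∀ i < n, c ≤ x i) :
    c * ∑ i ∈ range n, f i ≤ ∑ i ∈ range n, f i * x i := by
  induction n generalizing c with
  | zero => simp
  | succ n ih =>
    have h1 := ih (fun i j hij hj => hx i j hij (by omega)) (fun i hi => h0 i (by omega))
      (fun p hp => hf p (by omega)) (c := x n) (fun i hi => hx i n hi.le (by omega))
    have h2 := mul_le_mul_of_nonneg_right (hc n (by omega)) (hf (n + 1) le_rfl)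
    rw [sum_range_succ _ n] at h2 ⊢
    rw [sum_range_succ]
    linarith

theorem Fin.sum_mul_nonneg_of_antitone {n : ℕ} {f x : Fin n → ℝ} (hx : Antitone x)
    (h0 : ∀ i, 0 ≤ x i) (hf : ∀ p ≤ n, 0 ≤ ∑ i ∈ univ.filter fun i : Fin n => (i : ℕ) < p, f i) :
    0 ≤ ∑ i, f i * x i := by
  let F : ℕ → ℝ := fun i => if h : i < n then f ⟨i, h⟩ else 0
  let X : ℕ → ℝ := fun i => if h : i < n then x ⟨i, h⟩ else 0
  have hF : ∀ i : Fin n, F i = f i := fun i => dif_pos i.2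
  have hX : ∀ i : Fin n, X i = x i := fun i => dif_pos i.2
  have hX' : ∀ i (hi : i < n), X i = x ⟨i, hi⟩ := fun i hi => dif_pos hi
  have h := Finset.sum_range_mul_ge_of_antitone (f := F) (x := X) n
    (fun i j hij hj => by
      rw [hX' j hj, hX' i (by omega)]
      exact hx hij)
    (fun i hi => by
      rw [hX' i hi]
      exact h0 _)
    (fun p hp => by
      have : ∑ i ∈ range p, F i = ∑ i ∈ univ.filter fun i : Fin n => (i : ℕ) < p, f i := by
        rw [sum_filter]
        have h1 : ∀ i : Fin n, (if (i : ℕ) < p then f i else 0) =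
            (fun j : ℕ => if j < p then F j else 0) i := fun i => by simp [hF]
        rw [sum_congr rfl fun i _ => h1 i,
          Fin.sum_univ_eq_sum_range (fun j : ℕ => if j < p then F j else 0) n, ← sum_filter]
        congr 1
        ext j
        simp only [mem_range, mem_filter]
        omega
      rw [this]
      exact hf p hp)
    (c := 0) (fun i hi => by
      rw [hX' i hi]
      exact h0 _)
  rw [zero_mul, ← Fin.sum_univ_eq_sum_range (fun i => F i * X i) n] at h
  simpa only [hF, hX] using h

/-- A quadratic form whose prefix sums are nonnegative is nonnegative at nonnegative antitone
vectors. -/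
theorem Fin.sum_sum_mul_nonneg_of_antitone {n : ℕ} {M : Fin n → Fin n → ℝ} {x : Fin n → ℝ}
    (hM : ∀ i j, M i j = M j i) (hx : Antitone x) (h0 : ∀ i, 0 ≤ x i)
    (hf : ∀ p q, p ≤ q → q ≤ n →
      0 ≤ ∑ i ∈ univ.filter fun i : Fin n => (i : ℕ) < p, ∑ j ∈ univ.filter fun j : Fin n => (j : ℕ) < q, M i j) :
    0 ≤ ∑ i, ∑ j, M i j * (x i * x j) := by
  have h : ∀ i, ∑ j, M i j * (x i * x j) = (∑ j, M i j * x j) * x i := by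
    intro i
    rw [sum_mul]
    exact sum_congr rfl fun j _ => by ring
  simp only [h]
  refine Fin.sum_mul_nonneg_of_antitone hx h0 fun p hp => ?_
  rw [sum_comm]
  simp only [← sum_mul]
  refine Fin.sum_mul_nonneg_of_antitone hx h0 fun q hq => ?_
  rcases le_total p q with hpq | hpq
  · rw [sum_comm]
    exact hf p q hpq hq
  · refine (hf q p hpq hp).trans_eq ?_
    exact sum_congr rfl fun i _ => sum_congr rfl fun j _ => hM _ _

end Abel

/-! ### Prefix counts: degenerate graphs against `graphW`. -/

namespace SimpleGraph

open Finset

variable {V : Type*} {G : SimpleGraph V}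

open Classical in
theorem card_filter_adj_add_one_le {Q : Finset V} {u : V} (hu : u ∈ Q) :
    (Q.filter (G.Adj u)).card ≤ Q.card - 1 := by
  rw [← card_erase_of_mem hu]
  refine card_le_card fun x hx => ?_
  rw [mem_filter] at hx
  exact mem_erase.2 ⟨hx.2.ne', hx.1⟩

open Classical in
theorem card_filter_adj_eq_erase {Q : Finset V} {u v : V} (hv : v ∈ Q) :
    (Q.filter (G.Adj u)).card = ((Q.erase v).filter (G.Adj u)).card + if G.Adj v u then 1 else 0 := by
  conv_lhs => rw [← insert_erase hv, filter_insert]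
  simp only [G.adj_comm u v]
  split_ifs
  · rw [card_insert_of_notMem (by simp)]
  · rfl

open Classical in
/-- The number of ordered adjacent pairs in `P × Q`, for `P ⊆ Q`, in a graph that is `s`-degenerate
down to `r` vertices. -/
theorem IsDegenerateAbove.sum_card_filter_adj_le {r s : ℕ} (hG : G.IsDegenerateAbove r s)
    (hsr : s + 1 ≤ r) {P Q : Finset V} (hPQ : P ⊆ Q) (hQ : r ≤ Q.card) :
    ∑ u ∈ P, (Q.filter (G.Adj u)).card ≤
      min P.card r * (r - 1) + s * (Q.card - r) + s * (P.card - r) := by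
  induction hn : Q.card - r generalizing P Q with
  | zero =>
    have hP := card_le_card hPQ
    rw [min_eq_left (by omega), ← smul_eq_mul, ← sum_const]
    refine le_trans (sum_le_sum fun u hu => ?_) (Nat.le_add_right _ _)
    refine (card_filter_adj_add_one_le (hPQ hu)).trans ?_
    omega
  | succ d ih =>
    -- Deleting `v` from `Q` loses at most s pairs in which `v` is the second entry, and at most s
    -- more in which it is the first if `v ∈ P`.
    obtain ⟨v, hv, hvs⟩ := hG Q (by omega)
    have hQv := card_erase_of_mem hv
    have hdv : ∀ P' ⊆ Q, (∑ u ∈ P', if G.Adj v u then 1 else 0) ≤ s := by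
      intro P' hP'
      rw [← card_filter]
      exact (card_le_card (filter_subset_filter _ hP')).trans hvs
    by_cases hvP : v ∈ P
    · have h1 := ih (P := P.erase v) (Q := Q.erase v) (erase_subset_erase v hPQ) (by omega) (by omega)
      have h2 := hdv (P.erase v) ((erase_subset _ _).trans hPQ)
      rw [← add_sum_erase _ _ hvP, sum_congr rfl fun u _ => card_filter_adj_eq_erase (u := u) hv,
        sum_add_distrib]
      have hP1 : 1 ≤ P.card := card_pos.2 ⟨v, hvP⟩
      rw [card_erase_of_mem hvP] at h1
      rcases Nat.lt_or_ge r P.card with hr | hr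
      · rw [min_eq_right (by omega)] at h1 ⊢
        rw [show P.card - r = (P.card - 1 - r) + 1 by omega]
        linarith
      · rw [min_eq_left (by omega), show P.card - 1 - r = 0 by omega] at h1
        rw [min_eq_left hr, show P.card - r = 0 by omega]
        obtain ⟨c, hc⟩ : ∃ c, P.card = c + 1 := ⟨P.card - 1, by omega⟩
        rw [hc] at h1 ⊢
        rw [Nat.add_sub_cancel] at h1
        -- For |P| ≤ r the bound grows by (r - 1) + s, which has to absorb a loss of 2s.
        have : s ≤ r - 1 := by omega
        linarith
    · have h1 := ih (P := P) (Q := Q.erase v)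
        (fun x hx => mem_erase.2 ⟨fun h => hvP (h ▸ hx), hPQ hx⟩) (by omega) (by omega)
      have h2 := hdv P hPQ
      rw [sum_congr rfl fun u _ => card_filter_adj_eq_erase (u := u) hv, sum_add_distrib]
      linarith

section GraphW

variable {n k s : ℕ}

open Classical in
theorem card_filter_graphW_adj_of_lt {q : ℕ} (hq : q ≤ n) {u : Fin n} (hu : (u : ℕ) < q)
    (hus : (u : ℕ) < s ∨ q ≤ k - s) :
    q - 1 ≤ ((univ.filter fun j : Fin n => (j : ℕ) < q).filter ((graphW n k s).Adj u)).card := by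
  have h : (univ.filter fun j : Fin n => (j : ℕ) < q).card = q := by
    rw [Fin.card_filter_val_lt, min_eq_right hq]
  conv_lhs => rw [← h, ← card_erase_of_mem (show u ∈ univ.filter fun j : Fin n => (j : ℕ) < q by simpa)]
  refine card_le_card fun x hx => ?_
  simp only [mem_erase, mem_filter, mem_univ, true_and] at hx ⊢
  refine ⟨hx.2, hx.1.symm, ?_⟩
  omega

/-- Lower bound for the degree of vertex `i` of `graphW n k s` into the first `q` vertices. -/
def graphWRow (k s q i : ℕ) : ℕ := if i < s then q - 1 else if i < k - s then k - s - 1 else s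

open Classical in
theorem graphWRow_le {q : ℕ} (hq : q ≤ n) (hkq : k - s ≤ q) {u : Fin n}
    (hu : (u : ℕ) < q) : graphWRow k s q u ≤
      ((univ.filter fun j : Fin n => (j : ℕ) < q).filter ((graphW n k s).Adj u)).card := by
  rw [graphWRow]
  split_ifs with h1 h2
  · exact card_filter_graphW_adj_of_lt hq hu (Or.inl h1)
  · refine (card_filter_graphW_adj_of_lt (q := k - s) (s := s) (hkq.trans hq) h2 (Or.inr le_rfl)).trans
      (card_le_card (filter_subset_filter _ fun x hx => ?_))
    rw [mem_filter] at hx ⊢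
    exact ⟨hx.1, by omega⟩
  · have h : (univ.filter fun j : Fin n => (j : ℕ) < s).card = s := by
      rw [Fin.card_filter_val_lt, min_eq_right (by omega)]
    conv_lhs => rw [← h]
    refine card_le_card fun x hx => ?_
    simp only [mem_filter, mem_univ, true_and] at hx ⊢
    refine ⟨by omega, fun hux => ?_, by omega⟩
    rw [hux] at h1
    omega

/-- The s full rows of `X` give s(q-1) = s(k-s-1) + s(q-(k-s)). Each later row adds k-s-1 up to
index k-s and s after that, exactly as the left side does. -/
theorem le_sum_graphWRow {p q : ℕ} (hks : 2 * s < k) (hkq : k - s ≤ q) (hsp : s ≤ p) :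
    min p (k - s) * (k - s - 1) + s * (q - (k - s)) + s * (p - (k - s)) ≤
      ∑ i ∈ range p, graphWRow k s q i := by
  induction p, hsp using Nat.le_induction with
  | base =>
    rw [sum_congr rfl fun i hi => show graphWRow k s q i = q - 1 by
      rw [graphWRow, if_pos (mem_range.1 hi)], sum_const, card_range, smul_eq_mul,
      min_eq_left (by omega), show s - (k - s) = 0 by omega,
      show q - 1 = (k - s - 1) + (q - (k - s)) by omega]
    linarith
  | succ p hp ih =>
    rw [sum_range_succ]
    rcases Nat.lt_or_ge p (k - s) with h | h
    · rw [min_eq_left (by omega), show p - (k - s) = 0 by omega] at ih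
      rw [min_eq_left (by omega), show p + 1 - (k - s) = 0 by omega, graphWRow,
        if_neg (by omega), if_pos h]
      linarith
    · rw [min_eq_right (by omega)] at ih
      rw [min_eq_right (by omega), show p + 1 - (k - s) = (p - (k - s)) + 1 by omega, graphWRow,
        if_neg (by omega), if_neg (by omega)]
      linarith

theorem sum_fin_filter_lt (f : ℕ → ℕ) {p : ℕ} (hp : p ≤ n) :
    ∑ u ∈ univ.filter fun i : Fin n => (i : ℕ) < p, f u = ∑ i ∈ range p, f i := by
  rw [sum_filter, Fin.sum_univ_eq_sum_range (fun i => if i < p then f i else 0) n, ← sum_filter]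
  congr 1
  ext j
  simp only [mem_range, mem_filter]
  omega

open Classical in
/-- Among graphs that are `s`-degenerate down to `k - s` vertices, `graphW n k s` has the largest
prefix sums. -/
theorem IsDegenerateAbove.prefix_le [Fintype V] (hG : G.IsDegenerateAbove (k - s) s)
    (hks : 2 * s < k) (e : Fin n ≃ V) {p q : ℕ} (hpq : p ≤ q) (hq : q ≤ n) :
    ∑ i ∈ univ.filter fun i : Fin n => (i : ℕ) < p,
        ((univ.filter fun j : Fin n => (j : ℕ) < q).filter fun j => G.Adj (e i) (e j)).card ≤
      ∑ i ∈ univ.filter fun i : Fin n => (i : ℕ) < p,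
        ((univ.filter fun j : Fin n => (j : ℕ) < q).filter ((graphW n k s).Adj i)).card := by
  have hcard : ∀ p ≤ n, (univ.filter fun j : Fin n => (j : ℕ) < p).card = p := fun p hp => by
    rw [Fin.card_filter_val_lt, min_eq_right hp]
  set H := G.comap e with hH
  have hrow : ∀ i : Fin n, (i : ℕ) < q →
      ((univ.filter fun j : Fin n => (j : ℕ) < q).filter fun j => G.Adj (e i) (e j)).card ≤ q - 1 := by
    intro i hi
    have := card_filter_adj_add_one_le (G := H) (u := i)
      (Q := univ.filter fun j : Fin n => (j : ℕ) < q) (by simpa using hi)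
    rw [hcard q hq] at this
    simpa [hH] using this
  -- For q < k - s, or p < s, the rows of `graphW` in question are full and the comparison is
  -- trivial; peeling is needed only otherwise.
  rcases Nat.lt_or_ge q (k - s) with hqk | hqk
  · refine sum_le_sum fun i hi => ?_
    simp only [mem_filter, mem_univ, true_and] at hi
    exact (hrow i (by omega)).trans (card_filter_graphW_adj_of_lt hq (by omega) (Or.inr hqk.le))
  rcases Nat.lt_or_ge p s with hps | hps
  · refine sum_le_sum fun i hi => ?_
    simp only [mem_filter, mem_univ, true_and] at hi
    exact (hrow i (by omega)).trans (card_filter_graphW_adj_of_lt hq (by omega) (Or.inl (by omega)))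
  have h1 := hG.sum_card_filter_adj_le (by omega)
    (P := (univ.filter fun i : Fin n => (i : ℕ) < p).map e.toEmbedding)
    (Q := (univ.filter fun i : Fin n => (i : ℕ) < q).map e.toEmbedding)
    (map_subset_map.2 fun x hx => by
      rw [mem_filter] at hx ⊢
      exact ⟨hx.1, by omega⟩) (by rwa [card_map, hcard q hq])
  rw [card_map, card_map, hcard p (by omega), hcard q hq, sum_map] at h1
  simp only [filter_map, card_map] at h1
  refine h1.trans ((le_sum_graphWRow hks hqk hps).trans ?_)
  rw [← sum_fin_filter_lt _ (hpq.trans hq)]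
  refine sum_le_sum fun i hi => ?_
  simp only [mem_filter, mem_univ, true_and] at hi
  exact graphWRow_le hq hqk (by omega)

open Matrix in
/-- Among graphs that are `s`-degenerate down to `k - s` vertices, `graphW n k s` has the largest
spectral radius. -/
theorem IsDegenerateAbove.graphSpectralRadius_le [Fintype V] (hG : G.IsDegenerateAbove (k - s) s)
    (hks : 2 * s < k) (hn : 0 < n) (hV : Fintype.card V = n) :
    graphSpectralRadius G ≤ graphSpectralRadius (graphW n k s) := by
  classical
  have : Nonempty V := Fintype.card_pos_iff.1 (hV ▸ hn)
  obtain ⟨x, hx0, hxx, hx⟩ := exists_nonneg_graphSpectralRadius_le G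
  let e₀ : Fin n ≃ V := (Fintype.equivFinOfCardEq hV).symm
  -- Sorting `-x` increasingly puts the large entries of `x` on the small labels, where `graphW` has
  -- its dominating vertices.
  let e : Fin n ≃ V := (Tuple.sort fun i => -x (e₀ i)).trans e₀
  let y : Fin n → ℝ := fun i => x (e i)
  have hy : Antitone y := fun i j hij => by
    have := Tuple.monotone_sort (fun i => -x (e₀ i)) hij
    simpa [y, e] using this
  have hyy : y ⬝ᵥ y = x ⬝ᵥ x := e.sum_comp fun i => x i * x i
  have hxA : x ⬝ᵥ G.adjMatrix ℝ *ᵥ x = ∑ i, ∑ j, (if G.Adj (e i) (e j) then 1 else 0) * (y i * y j) := by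
    simp only [dotProduct, mulVec, mul_sum, adjMatrix_apply]
    rw [← e.sum_comp]
    refine sum_congr rfl fun i _ => ?_
    rw [← e.sum_comp]
    exact sum_congr rfl fun j _ => by ring
  have hyA : y ⬝ᵥ (graphW n k s).adjMatrix ℝ *ᵥ y =
      ∑ i, ∑ j, (if (graphW n k s).Adj i j then 1 else 0) * (y i * y j) := by
    simp only [dotProduct, mulVec, mul_sum, adjMatrix_apply]
    exact sum_congr rfl fun i _ => sum_congr rfl fun j _ => by ring
  have hnn := Fin.sum_sum_mul_nonneg_of_antitone
    (M := fun i j => (if (graphW n k s).Adj i j then 1 else 0) - if G.Adj (e i) (e j) then 1 else 0)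
    (fun i j => by simp only [adj_comm]) hy (fun i => hx0 _) (fun p q hpq hq => by
      have := hG.prefix_le hks e hpq hq
      simp only [sum_sub_distrib, sub_nonneg, sum_boole]
      exact_mod_cast this)
  simp only [sub_mul, sum_sub_distrib, ← hxA, ← hyA] at hnn
  have hW := dotProduct_mulVec_le_graphSpectralRadius (graphW n k s) y
  rw [hyy] at hW
  exact le_of_mul_le_mul_right (by linarith) hxx

end GraphW

end SimpleGraph

/-! ### Connectivity of `graphW`, and its lack of long paths, long cycles and large matchings. -/

namespace SimpleGraph

variable {V : Type*} {G : SimpleGraph V}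

theorem connected_of_forall_adj {u : V} (h : ∀ w, w ≠ u → G.Adj u w) : G.Connected := by
  rw [connected_iff_exists_forall_reachable]
  refine ⟨u, fun w => ?_⟩
  by_cases hw : w = u
  · rw [hw]
  · exact (h w hw).reachable

section GraphW

variable {n k s : ℕ}

theorem graphW_connected (hs : 1 ≤ s) (hn : 1 ≤ n) : (graphW n k s).Connected :=
  connected_of_forall_adj (u := ⟨0, hn⟩) fun _ hw => ⟨hw.symm, Or.inl hs⟩

theorem graphW_isTwoConnected (hs : 2 ≤ s) (hn : 3 ≤ n) : IsTwoConnected (graphW n k s) := by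
  refine ⟨by simpa, graphW_connected (by omega) (by omega), fun v => ?_⟩
  obtain ⟨u, hus, huv⟩ : ∃ u : Fin n, (u : ℕ) < s ∧ u ≠ v := by
    by_cases hv : (v : ℕ) = 0
    · refine ⟨⟨1, by omega⟩, hs, fun h => ?_⟩
      rw [← h] at hv
      simp at hv
    · refine ⟨⟨0, by omega⟩, by simp only; omega, fun h => ?_⟩
      rw [← h] at hv
      simp at hv
  exact connected_of_forall_adj (u := ⟨u, huv⟩) fun w hw =>
    ⟨fun h => hw (Subtype.ext h.symm), Or.inl hus⟩

/-- On a walk of `graphW`, the vertices of the independent part `Z` are separated by vertices of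
the dominating part `X`. -/
theorem countP_support_graphW (hks : 2 * s ≤ k) {a b : Fin n} (p : (graphW n k s).Walk a b) :
    p.support.countP (fun x : Fin n => decide (k - s ≤ (x : ℕ))) ≤
        p.support.countP (fun x : Fin n => decide ((x : ℕ) < s)) + (if k - s ≤ (a : ℕ) then 1 else 0) ∧
      ((∃ y ∈ p.support, s ≤ (y : ℕ) ∧ (y : ℕ) < k - s) →
        p.support.countP (fun x : Fin n => decide (k - s ≤ (x : ℕ))) + (if (a : ℕ) < s then 1 else 0) ≤
          p.support.countP (fun x : Fin n => decide ((x : ℕ) < s))) := by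
  induction p with
  | @nil a =>
    simp only [Walk.support_nil, List.countP_singleton, List.mem_singleton, exists_eq_left,
      decide_eq_true_eq]
    split_ifs <;> omega
  | @cons a c b h p ih =>
    have hadj := h.2
    obtain ⟨ih1, ih2⟩ := ih
    simp only [Walk.support_cons, List.countP_cons, decide_eq_true_eq, List.mem_cons,
      exists_eq_or_imp]
    refine ⟨?_, ?_⟩
    · split_ifs at * <;> omega
    · rintro (hy | hy)
      · split_ifs at * <;> omega
      · have ih2 := ih2 hy
        split_ifs at * <;> omega

theorem countP_lt_le_of_nodup {L : List (Fin n)} (hL : L.Nodup) (m : ℕ) :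
    L.countP (fun x : Fin n => decide ((x : ℕ) < m)) ≤ m := by
  rw [List.countP_eq_length_filter, ← List.toFinset_card_of_nodup (hL.filter _)]
  refine (Finset.card_le_card (t := Finset.univ.filter fun x : Fin n => (x : ℕ) < m) fun x hx => ?_).trans ?_
  · simpa using (List.mem_filter.1 (List.mem_toFinset.1 hx)).2
  · rw [Fin.card_filter_val_lt]
    exact min_le_right _ _

theorem length_eq_countP_lt_add (L : List (Fin n)) (m : ℕ) :
    L.length = L.countP (fun x : Fin n => decide ((x : ℕ) < m)) + L.countP (fun x : Fin n => decide (m ≤ (x : ℕ))) := by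
  rw [L.length_eq_countP_add_countP fun x : Fin n => decide ((x : ℕ) < m)]
  congr 1
  refine List.countP_congr fun x _ => ?_
  simp

/-- At most k - s vertices lie outside `Z`. If the path meets `Y`, it has at most as many vertices
in `Z` as in `X`, hence at most s; if not, it has at most 2s + 1 vertices. A start in `X` saves one
vertex in either case. -/
theorem length_support_graphW_le (hks : 2 * s < k) {a b : Fin n} {p : (graphW n k s).Walk a b}
    (hp : p.IsPath) : p.support.length ≤ k ∧ ((a : ℕ) < s → p.support.length < k) := by
  have hX := countP_lt_le_of_nodup hp.support_nodup s
  have hXY := countP_lt_le_of_nodup hp.support_nodup (k - s)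
  have hlen := length_eq_countP_lt_add p.support (k - s)
  obtain ⟨h1, h2⟩ := countP_support_graphW hks.le p
  by_cases hy : ∃ y ∈ p.support, s ≤ (y : ℕ) ∧ (y : ℕ) < k - s
  · have := h2 hy
    split_ifs at * <;> omega
  · have : p.support.countP (fun x : Fin n => decide ((x : ℕ) < k - s)) =
        p.support.countP (fun x : Fin n => decide ((x : ℕ) < s)) := by
      refine List.countP_congr fun x hx => ?_
      simp only [decide_eq_true_eq]
      refine ⟨fun h => ?_, fun h => by omega⟩
      by_contra h'
      exact hy ⟨x, hx, by omega, h⟩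
    split_ifs at * <;> omega

theorem not_hasPathOfOrder_graphW (hks : 2 * s < k) : ¬ HasPathOfOrder (graphW n k s) (k + 1) := by
  rintro ⟨u, v, p, hp, hl⟩
  have := (length_support_graphW_le hks hp).1
  omega

/-- A cycle of length at least k cannot fit into the k - s vertices of X ∪ Y, so it can be started
in `Z`. Its second vertex is then in `X`, and the remaining path from there has fewer than k
vertices. -/
theorem not_hasCycleAtLeast_graphW (hs : 1 ≤ s) (hks : 2 * s < k) :
    ¬ HasCycleAtLeast (graphW n k s) k := by
  rintro ⟨v, c, hc, hk⟩
  obtain ⟨x, hx, hxs⟩ : ∃ x ∈ c.support, k - s ≤ (x : ℕ) := by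
    by_contra! h
    have h1 := countP_lt_le_of_nodup hc.support_nodup (k - s)
    rw [List.countP_eq_length.2 fun x hx => by simpa using h x (List.mem_of_mem_tail hx),
      List.length_tail, Walk.length_support] at h1
    omega
  have hc' := hc.rotate hx
  have hk' : k ≤ (c.rotate x hx).length := by rwa [Walk.length_rotate]
  generalize c.rotate x hx = c' at hc' hk'
  cases c' with
  | nil => exact hc'.ne_nil rfl
  | @cons _ w _ h q =>
    rw [Walk.cons_isCycle_iff] at hc'
    rw [Walk.length_cons] at hk'
    have hw : (w : ℕ) < s := by
      have := h.2
      omega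
    have := (length_support_graphW_le hks hc'.1).2 hw
    rw [Walk.length_support] at this
    omega

-- Give weight 2 to `X`, 1 to `Y` and 0 to `Z`. Every edge carries weight at least 2 and the total
-- is 2m + 1, so independent edges number at most m.
open Finset in
theorem not_hasMatchingOfSize_graphW {m : ℕ} (hsm : s ≤ m) :
    ¬ HasMatchingOfSize (graphW n (2 * m + 1) s) (m + 1) := by
  classical
  rintro ⟨M, hM, hfin, hcard⟩
  let wt : Fin n → ℕ := fun v => (if (v : ℕ) < s then 1 else 0) + if (v : ℕ) < 2 * m + 1 - s then 1 else 0
  have hE : hfin.toFinset.card = m + 1 := by rw [← Set.ncard_eq_toFinset_card _ hfin, hcard]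
  have h1 : ∀ e ∈ hfin.toFinset, 2 ≤ ∑ v, if v ∈ e then wt v else 0 := by
    intro e he
    rw [Set.Finite.mem_toFinset] at he
    induction e using Sym2.ind with
    | _ a b =>
      rw [Subgraph.mem_edgeSet] at he
      have hadj := M.adj_sub he
      rw [← sum_filter]
      have : ({a, b} : Finset (Fin n)) ⊆ univ.filter fun v => v ∈ s(a, b) := by
        intro x hx
        simpa using hx
      refine le_trans ?_ (sum_le_sum_of_subset this)
      rw [sum_pair hadj.1]
      have := hadj.2
      simp only [wt]
      split_ifs <;> omega
  have h2 : ∀ v, (hfin.toFinset.filter fun e => v ∈ e).card ≤ 1 := by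
    intro v
    rw [card_le_one]
    intro e he e' he'
    simp only [mem_filter, Set.Finite.mem_toFinset] at he he'
    obtain ⟨a, rfl⟩ := Sym2.mem_iff_exists.1 he.2
    obtain ⟨b, rfl⟩ := Sym2.mem_iff_exists.1 he'.2
    rw [hM.eq_of_adj_left (Subgraph.mem_edgeSet.1 he.1) (Subgraph.mem_edgeSet.1 he'.1)]
  have h3 : ∑ v, wt v ≤ 2 * m + 1 := by
    simp only [wt, sum_add_distrib, sum_boole, Fin.card_filter_val_lt, Nat.cast_id]
    omega
  have h4 := sum_le_sum h1
  rw [sum_const, hE, sum_comm] at h4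
  have h5 : ∑ v, ∑ e ∈ hfin.toFinset, (if v ∈ e then wt v else 0) ≤ ∑ v, wt v := by
    refine sum_le_sum fun v _ => ?_
    rw [← sum_filter, sum_const, smul_eq_mul]
    exact (Nat.mul_le_mul_right _ (h2 v)).trans_eq (one_mul _)
  rw [smul_eq_mul] at h4
  omega

end GraphW

/-- Every other edge of a path on `2 * m` vertices forms a matching. -/
theorem _root_.HasPathOfOrder.hasMatchingOfSize {m : ℕ} (h : HasPathOfOrder G (2 * m)) :
    HasMatchingOfSize G m := by
  classical
  obtain ⟨a, b, p, hp, hl⟩ := h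
  obtain ⟨v, hinj, hadj, -⟩ := (PathOn.of_isPath hp).exists_enum
  rw [List.toFinset_card_of_nodup hp.support_nodup, hl] at hinj hadj
  have hinj' : ∀ i j, i < 2 * m → j < 2 * m → v i = v j → i = j := fun i j hi hj h => hinj hi hj h
  let M : G.Subgraph :=
    { verts := {x | ∃ i < 2 * m, v i = x}
      Adj := fun x y => ∃ i < m, (v (2 * i) = x ∧ v (2 * i + 1) = y) ∨ (v (2 * i) = y ∧ v (2 * i + 1) = x)
      adj_sub := by
        rintro x y ⟨i, hi, ⟨rfl, rfl⟩ | ⟨rfl, rfl⟩⟩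
        · exact hadj _ (by omega)
        · exact (hadj _ (by omega)).symm
      edge_vert := by
        rintro x y ⟨i, hi, ⟨rfl, rfl⟩ | ⟨rfl, rfl⟩⟩
        · exact ⟨_, by omega, rfl⟩
        · exact ⟨_, by omega, rfl⟩
      symm := ⟨fun x y ⟨i, hi, h⟩ => ⟨i, hi, h.symm⟩⟩ }
  have hE : M.edgeSet = (fun i => s(v (2 * i), v (2 * i + 1))) '' (Finset.range m : Set ℕ) := by
    ext e
    induction e using Sym2.ind with
    | _ x y =>
      rw [Subgraph.mem_edgeSet]
      simp only [Set.mem_image, Finset.coe_range, Set.mem_Iio, Sym2.eq_iff]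
      rfl
  refine ⟨M, ?_, ?_, ?_⟩
  · rintro x ⟨i, hi, rfl⟩
    rcases Nat.even_or_odd' i with ⟨j, rfl | rfl⟩
    · refine ⟨v (2 * j + 1), ⟨j, by omega, Or.inl ⟨rfl, rfl⟩⟩, ?_⟩
      rintro y ⟨l, hl, ⟨h, rfl⟩ | ⟨rfl, h⟩⟩
      · have := hinj' _ _ (by omega) hi h
        rw [this]
      · have := hinj' _ _ (by omega) hi h
        omega
    · refine ⟨v (2 * j), ⟨j, by omega, Or.inr ⟨rfl, rfl⟩⟩, ?_⟩
      rintro y ⟨l, hl, ⟨h, rfl⟩ | ⟨rfl, h⟩⟩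
      · have := hinj' _ _ (by omega) hi h
        omega
      · have := hinj' _ _ (by omega) hi h
        rw [show 2 * l = 2 * j by omega]
  · rw [hE]
    exact (Finset.finite_toSet _).image _
  · rw [hE, Set.InjOn.ncard_image, Set.ncard_coe_finset, Finset.card_range]
    intro i hi j hj hij
    rw [Finset.mem_coe, Finset.mem_range] at hi hj
    rcases Sym2.eq_iff.1 hij with ⟨h, -⟩ | ⟨h, -⟩
    · have := hinj' _ _ (by omega) (by omega) h
      omega
    · have := hinj' _ _ (by omega) (by omega) h
      omega

end SimpleGraph

/-! ### Adding a dominating vertex: from cycles to paths. -/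

namespace SimpleGraph

variable {V : Type*} {G : SimpleGraph V}

/-- The graph obtained from `G` by adding a vertex adjacent to all others. -/
def cone (G : SimpleGraph V) : SimpleGraph (Option V) where
  Adj x y := x ≠ y ∧ ∀ a ∈ x, ∀ b ∈ y, G.Adj a b
  symm := ⟨fun _ _ h => ⟨h.1.symm, fun a ha b hb => (h.2 b hb a ha).symm⟩⟩
  loopless := ⟨fun _ h => h.1 rfl⟩

@[simp]
theorem cone_adj_some {a b : V} : G.cone.Adj (some a) (some b) ↔ G.Adj a b := by
  simp only [cone, Option.mem_def, Option.some.injEq, forall_eq', ne_eq, and_iff_right_iff_imp]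
  exact fun h => h.ne

@[simp]
theorem cone_adj_none {a : V} : G.cone.Adj none (some a) := by
  simp [cone]

theorem Connected.induce_cone_preconnected (hG : G.Connected) (c : Option V) :
    (G.cone.induce ({c}ᶜ : Set (Option V))).Preconnected := by
  cases c with
  | none =>
    let f : G →g G.cone.induce ({none}ᶜ : Set (Option V)) :=
      ⟨fun a => ⟨some a, by simp⟩, fun {a b} h => cone_adj_some.2 h⟩
    rintro ⟨x, hx⟩ ⟨y, hy⟩
    obtain ⟨a, rfl⟩ := Option.ne_none_iff_exists'.1 hx
    obtain ⟨b, rfl⟩ := Option.ne_none_iff_exists'.1 hy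
    exact (hG.preconnected a b).map f
  | some c =>
    refine (connected_of_forall_adj (u := ⟨none, by simp⟩) ?_).preconnected
    rintro ⟨w, hw⟩ hne
    obtain ⟨a, rfl⟩ := Option.ne_none_iff_exists'.1 fun h : w = none => hne (Subtype.ext h)
    exact cone_adj_none

theorem exists_walk_of_cone_walk {x y : Option V} (p : G.cone.Walk x y) (hp : none ∉ p.support)
    {a : V} (ha : x = some a) : ∃ (b : V) (q : G.Walk a b), q.support.map some = p.support := by
  induction p generalizing a with
  | nil =>
    subst ha
    exact ⟨a, Walk.nil, rfl⟩
  | @cons x z y h p ih =>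
    subst ha
    rw [Walk.support_cons, List.mem_cons, not_or] at hp
    obtain ⟨c, rfl⟩ := Option.ne_none_iff_exists'.1 fun h : z = none =>
      hp.2 (h ▸ p.start_mem_support)
    obtain ⟨b, q, hq⟩ := ih hp.2 rfl
    exact ⟨b, Walk.cons (cone_adj_some.1 h) q, by simp [hq]⟩

theorem hasPathOfOrder_of_le {u v : V} {p : G.Walk u v} (hp : p.IsPath) {k : ℕ} (hk : 1 ≤ k)
    (hkp : k ≤ p.support.length) : HasPathOfOrder G k := by
  refine ⟨_, _, p.take (k - 1), hp.take _, ?_⟩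
  rw [Walk.length_support] at hkp ⊢
  rw [Walk.take_length]
  omega

theorem hasPathOfOrder_of_cone_path {x y : Option V} {p : G.cone.Walk x y} (hp : p.IsPath)
    (hnone : none ∉ p.support) {k : ℕ} (hk : 1 ≤ k) (hkp : k ≤ p.support.length) :
    HasPathOfOrder G k := by
  obtain ⟨a, ha⟩ := Option.ne_none_iff_exists'.1 fun h : x = none => hnone (h ▸ p.start_mem_support)
  obtain ⟨b, q, hq⟩ := exists_walk_of_cone_walk p hnone ha
  have hnd := hp.support_nodup
  rw [← hq] at hnd hkp
  rw [List.length_map] at hkp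
  exact hasPathOfOrder_of_le (Walk.IsPath.mk' (List.Nodup.of_map _ hnd)) hk hkp

/-- Deleting the apex from a cycle through it leaves a path with one vertex fewer; a cycle avoiding
the apex needs only to be opened. -/
theorem _root_.HasCycleAtLeast.hasPathOfOrder_of_cone {k : ℕ} (hk : 1 ≤ k)
    (h : HasCycleAtLeast G.cone (k + 1)) : HasPathOfOrder G k := by
  classical
  obtain ⟨v, c, hc, hkc⟩ := h
  by_cases hn : none ∈ c.support
  · have hc' := hc.rotate hn
    have hk' : k + 1 ≤ (c.rotate none hn).length := by rwa [Walk.length_rotate]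
    generalize c.rotate none hn = c' at hc' hk'
    cases c' with
    | nil => exact absurd rfl hc'.ne_nil
    | @cons _ w _ h q =>
      rw [Walk.cons_isCycle_iff] at hc'
      rw [Walk.length_cons] at hk'
      have hq := hc'.1.reverse
      have hl : q.reverse.length = q.length := q.length_reverse
      generalize q.reverse = q' at hq hl
      cases q' with
      | nil => exact absurd rfl h.ne
      | cons h' q' =>
        rw [Walk.cons_isPath_iff] at hq
        refine hasPathOfOrder_of_cone_path hq.1 hq.2 hk ?_
        rw [Walk.length_cons] at hl
        rw [Walk.length_support]
        omega
  · cases c with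
    | nil => exact absurd rfl hc.ne_nil
    | cons h q =>
      rw [Walk.cons_isCycle_iff] at hc
      rw [Walk.support_cons, List.mem_cons, not_or] at hn
      rw [Walk.length_cons] at hkc
      refine hasPathOfOrder_of_cone_path hc.1 hn.2 hk ?_
      rw [Walk.length_support]
      omega

/-- Adjoin the apex to `U`. It has more than `r ≥ s + 1` neighbours there, so the vertex of small
degree lies in `U`, and the apex accounts for one of its neighbours. -/
theorem IsDegenerateAbove.of_cone {r s : ℕ} (h : G.cone.IsDegenerateAbove (r + 1) (s + 1))
    (hsr : s + 1 ≤ r) : G.IsDegenerateAbove r s := by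
  classical
  intro U hU
  obtain ⟨u, hu, hus⟩ := h (Finset.insertNone U) (by rw [Finset.card_insertNone]; omega)
  cases u with
  | none =>
    have : U.map Function.Embedding.some ⊆ (Finset.insertNone U).filter (G.cone.Adj none) := by
      intro x hx
      obtain ⟨a, ha, rfl⟩ := Finset.mem_map.1 hx
      exact Finset.mem_filter.2 ⟨Finset.some_mem_insertNone.2 ha, cone_adj_none⟩
    have := Finset.card_le_card this
    rw [Finset.card_map] at this
    omega
  | some u =>
    refine ⟨u, Finset.some_mem_insertNone.1 hu, ?_⟩
    have : Finset.insertNone (U.filter (G.Adj u)) ⊆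
        (Finset.insertNone U).filter (G.cone.Adj (some u)) := by
      intro x hx
      cases x with
      | none => exact Finset.mem_filter.2 ⟨Finset.none_mem_insertNone, cone_adj_none.symm⟩
      | some a =>
        rw [Finset.some_mem_insertNone, Finset.mem_filter] at hx
        exact Finset.mem_filter.2 ⟨Finset.some_mem_insertNone.2 hx.1, cone_adj_some.2 hx.2⟩
    have := Finset.card_le_card this
    rw [Finset.card_insertNone] at this
    omega

variable [Fintype V] {n k : ℕ}

/-- A 2-connected graph without long cycles has spectral radius at most that of some `graphW`. -/
theorem exists_graphSpectralRadius_le_of_not_hasCycleAtLeast (hk : 5 ≤ k) (hkn : k ≤ n)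
    (hV : Fintype.card V = n) (hG : IsTwoConnected G) (hc : ¬ HasCycleAtLeast G k) :
    ∃ s ∈ Finset.Icc 2 ((k - 1) / 2), graphSpectralRadius G ≤ graphSpectralRadius (graphW n k s) := by
  obtain ⟨s, hs, hst, hD⟩ := exists_isDegenerateAbove (fun c => (hG.2.2 c).preconnected) hk
    (hV ▸ hkn) hc
  exact ⟨s, Finset.mem_Icc.2 ⟨hs, hst⟩, hD.graphSpectralRadius_le (by omega) (by omega) hV⟩

/-- A connected graph without long paths has spectral radius at most that of some `graphW`. -/
theorem exists_graphSpectralRadius_le_of_not_hasPathOfOrder (hk : 4 ≤ k) (hkn : k ≤ n)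
    (hV : Fintype.card V = n) (hG : G.Connected) (hp : ¬ HasPathOfOrder G k) :
    ∃ s ∈ Finset.Icc 1 (k / 2 - 1),
      graphSpectralRadius G ≤ graphSpectralRadius (graphW n (k - 1) s) := by
  obtain ⟨s, hs, hst, hD⟩ := exists_isDegenerateAbove (G := G.cone) (k := k + 1)
    hG.induce_cone_preconnected (by omega) (by rw [Fintype.card_option]; omega)
    (fun h => hp (h.hasPathOfOrder_of_cone (by omega)))
  -- The cone has parameters k + 1 and s; removing the apex lowers both k + 1 - s and s by one,
  -- which gives k - 1 and s - 1.
  refine ⟨s - 1, Finset.mem_Icc.2 ⟨by omega, by omega⟩, ?_⟩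
  refine IsDegenerateAbove.graphSpectralRadius_le (IsDegenerateAbove.of_cone ?_ ?_) (by omega)
    (by omega) hV
  · rwa [show k - 1 - (s - 1) + 1 = k + 1 - s by omega, show s - 1 + 1 = s by omega]
  · omega

end SimpleGraph

/-! ### Upper bounds by the maximum over s, and the final theorem. -/

theorem le_maxRadiusW {n k a b s : ℕ} (hab : a ≤ b) (hs : s ∈ Finset.Icc a b) :
    graphSpectralRadius (graphW n k s) ≤ maxRadiusW n k a b hab :=
  Finset.le_sup' (fun s => graphSpectralRadius (graphW n k s)) hs

theorem exists_eq_maxRadiusW {n k a b : ℕ} (hab : a ≤ b) :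
    ∃ s, a ≤ s ∧ s ≤ b ∧ graphSpectralRadius (graphW n k s) = maxRadiusW n k a b hab := by
  obtain ⟨s, hs, h⟩ := Finset.exists_mem_eq_sup' (Finset.nonempty_Icc.mpr hab)
    fun s => graphSpectralRadius (graphW n k s)
  rw [Finset.mem_Icc] at hs
  exact ⟨s, hs.1, hs.2, h.symm⟩

section Upper

variable {V : Type*} [Fintype V] {G : SimpleGraph V} {n k : ℕ}

theorem graphSpectralRadius_le_of_not_hasCycleAtLeast (hk : 5 ≤ k) (hkn : k ≤ n)
    (hV : Fintype.card V = n) (hG : IsTwoConnected G) (hc : ¬ HasCycleAtLeast G k) :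
    graphSpectralRadius G ≤ maxRadiusW n k 2 ((k - 1) / 2) (by omega) := by
  obtain ⟨s, hs, hle⟩ :=
    SimpleGraph.exists_graphSpectralRadius_le_of_not_hasCycleAtLeast hk hkn hV hG hc
  exact hle.trans (le_maxRadiusW _ hs)

theorem graphSpectralRadius_le_of_not_hasPathOfOrder (hk : 4 ≤ k) (hkn : k ≤ n)
    (hV : Fintype.card V = n) (hG : G.Connected) (hp : ¬ HasPathOfOrder G k) :
    graphSpectralRadius G ≤ maxRadiusW n (k - 1) 1 (k / 2 - 1) (by omega) := by
  obtain ⟨s, hs, hle⟩ :=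
    SimpleGraph.exists_graphSpectralRadius_le_of_not_hasPathOfOrder hk hkn hV hG hp
  exact hle.trans (le_maxRadiusW _ hs)

theorem graphSpectralRadius_le_of_not_hasMatchingOfSize (hk : 1 ≤ k) (hkn : 2 * k + 2 ≤ n)
    (hV : Fintype.card V = n) (hG : G.Connected) (hm : ¬ HasMatchingOfSize G (k + 1)) :
    graphSpectralRadius G ≤ maxRadiusW n (2 * k + 1) 1 k hk := by
  obtain ⟨s, hs, hle⟩ := SimpleGraph.exists_graphSpectralRadius_le_of_not_hasPathOfOrder
    (k := 2 * (k + 1)) (by omega) (by omega) hV hG fun h => hm h.hasMatchingOfSize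
  rw [show 2 * (k + 1) / 2 - 1 = k by omega] at hs
  exact hle.trans (le_maxRadiusW hk hs)

end Upper

theorem theorem4p7 :
    -- (i) long cycles in 2-connected graphs, with `t = ⌊(k - 1) / 2⌋`
    (∀ (n k : ℕ) (hk : 5 ≤ k) (_ : k ≤ n),
      (∀ (V : Type*) [Fintype V] (G : SimpleGraph V), Fintype.card V = n → IsTwoConnected G →
        maxRadiusW n k 2 ((k - 1) / 2) (by omega) < graphSpectralRadius G →
        HasCycleAtLeast G k) ∧
      IsSpexTwoConnectedCycles n k (maxRadiusW n k 2 ((k - 1) / 2) (by omega))) ∧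
    -- (ii) paths in connected graphs, with `t = ⌊k / 2⌋ - 1`
    (∀ (n k : ℕ) (hk : 4 ≤ k) (_ : k ≤ n),
      (∀ (V : Type*) [Fintype V] (G : SimpleGraph V), Fintype.card V = n → G.Connected →
        maxRadiusW n (k - 1) 1 (k / 2 - 1) (by omega) < graphSpectralRadius G →
        HasPathOfOrder G k) ∧
      IsSpexConnectedPath n k (maxRadiusW n (k - 1) 1 (k / 2 - 1) (by omega))) ∧
    -- (iii) matchings in connected graphs
    (∀ (n k : ℕ) (hk : 1 ≤ k) (_ : 2 * k + 2 ≤ n),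
      (∀ (V : Type*) [Fintype V] (G : SimpleGraph V), Fintype.card V = n → G.Connected →
        maxRadiusW n (2 * k + 1) 1 k hk < graphSpectralRadius G →
        HasMatchingOfSize G (k + 1)) ∧
      IsSpexConnectedMatching n (k + 1) (maxRadiusW n (2 * k + 1) 1 k hk)) := by
  refine ⟨fun n k hk hkn => ⟨fun V _ G hV hG hlt => ?_, ?_, ?_⟩,
    fun n k hk hkn => ⟨fun V _ G hV hG hlt => ?_, ?_, ?_⟩,
    fun n k hk hkn => ⟨fun V _ G hV hG hlt => ?_, ?_, ?_⟩⟩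
  · by_contra hc
    exact hlt.not_ge (graphSpectralRadius_le_of_not_hasCycleAtLeast hk hkn hV hG hc)
  · obtain ⟨s, hs, hst, h⟩ := exists_eq_maxRadiusW (n := n) (k := k) (a := 2) (b := (k - 1) / 2)
      (by omega)
    exact ⟨graphW n k s, SimpleGraph.graphW_isTwoConnected hs (by omega),
      SimpleGraph.not_hasCycleAtLeast_graphW (by omega) (by omega), h⟩
  · rintro _ ⟨G, hG, hc, rfl⟩
    exact graphSpectralRadius_le_of_not_hasCycleAtLeast hk hkn (Fintype.card_fin n) hG hc
  · by_contra hp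
    exact hlt.not_ge (graphSpectralRadius_le_of_not_hasPathOfOrder hk hkn hV hG hp)
  · obtain ⟨s, hs, hst, h⟩ := exists_eq_maxRadiusW (n := n) (k := k - 1) (a := 1) (b := k / 2 - 1)
      (by omega)
    refine ⟨graphW n (k - 1) s, SimpleGraph.graphW_connected hs (by omega), ?_, h⟩
    have := SimpleGraph.not_hasPathOfOrder_graphW (n := n) (k := k - 1) (s := s) (by omega)
    rwa [show k - 1 + 1 = k by omega] at this
  · rintro _ ⟨G, hG, hp, rfl⟩
    exact graphSpectralRadius_le_of_not_hasPathOfOrder hk hkn (Fintype.card_fin n) hG hp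
  · by_contra hm
    exact hlt.not_ge (graphSpectralRadius_le_of_not_hasMatchingOfSize hk hkn hV hG hm)
  · obtain ⟨s, hs, hst, h⟩ := exists_eq_maxRadiusW (n := n) (k := 2 * k + 1) hk
    exact ⟨graphW n (2 * k + 1) s, SimpleGraph.graphW_connected hs (by omega),
      SimpleGraph.not_hasMatchingOfSize_graphW hst, h⟩
  · rintro _ ⟨G, hG, hm, rfl⟩
    exact graphSpectralRadius_le_of_not_hasMatchingOfSize hk hkn (Fintype.card_fin n) hG hm
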